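/- Let $k\ge 1$ be an integer. All graphs are finite undirected multigraphs without loops (parallel edges are allowed). A feasible solution in a graph $G$ is a tuple $F=(F_1,\dots,F_k)$ of pairwise edge-disjoint forests in $G$; its size $|F|$ is the number of edges of $F_1\sqcup\dots\sqcup F_k$, and $\mathrm{OPT}(G)$ is the maximum size of a feasible solution in $G$. We also write $F$ for the edge set $F_1\sqcup\dots\sqcup F_k$. A set $L\subseteq F$ of edges is a clump of $F$ if $L$ can be covered by $k$ forests and $|L|=k\cdot\mathrm{rk}(L)$, where $\mathrm{rk}(L)$ is the number of edges of a spanning forest of $L$. A top clump of $F$ is an inclusion-maximal clump of $F$. Starting from an input graph $G_0$ and $F=(\varnothing,\dots,\varnothing)$, repeat the following iteration, which takes the current graph $G$ and solution $F$ to a new pair $(G',F')$: 1. Orient the edges of $F$ so that all indegrees are at most $k$. 2. Let $P\supseteq F$ be a set of edges of $G$ together with an orientation in which all indegrees are at most $k$, where $|P|$ is maximum among all edge sets of $G$ that contain $F$ and have such an orientation. 3. Let $H=(H_1,\dots,H_k)$ be pairwise edge-disjoint forests in the directed graph $P$ (orientations being ignored in the definition of a forest) such that every vertex has indegree at most $k$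 in $H_1\sqcup\dots\sqcup H_k$, with $|H|$ maximum. 4. Let $L$ be a top clump of $H_1\sqcup\dots\sqcup H_k$. Let $G'$ be obtained from $G$ by contracting each connected component of $L$ to a single vertex and deleting loops, and let $F'_i=H_i\cap E(G')$, where $E(G')$ is regarded as a subset of $E(G)$. All choices in these steps are arbitrary. Then for every pair $(G,F)$ that is current at the beginning of some iteration, and for every possible outcome $H$, $(G',F')$ of that iteration, $$\mathrm{OPT}(G')-|F'| \;=\; \mathrm{OPT}(G)-|H| \;\le\; \frac{k}{k+1}\,\bigl(\mathrm{OPT}(G)-|F|\bigr).$$ -/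

import Mathlib

namespace KForest

/-- A set `T` of edges of the multigraph `G` is a forest if it contains the edge set of no cycle.
A cycle of length `n + 1` consists of distinct vertices `v 0, …, v n` and distinct edges
`e 0, …, e n`, where `e i` joins `v i` and `v (i + 1)` (indices modulo `n + 1`). Length `1` is a
loop, and length `2` is a pair of parallel edges. -/
def IsForest {α β : Type*} (G : Graph α β) (T : Set β) : Prop :=
  T ⊆ G.edgeSet ∧
    ¬ ∃ (n : ℕ) (v : Fin (n + 1) → α) (e : Fin (n + 1) → β),
      Function.Injective v ∧ Function.Injective e ∧
        ∀ i, e i ∈ T ∧ G.IsLink (e i) (v i) (v (i + 1))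

/-- A feasible solution of the `k`-forest problem in `G`: edge-disjoint forests
`F 0, …, F (k - 1)`. -/
def IsFeasible {α β : Type*} (G : Graph α β) (k : ℕ) (F : Fin k → Set β) : Prop :=
  (∀ i, IsForest G (F i)) ∧ ∀ i j, i ≠ j → Disjoint (F i) (F j)

/-- The number of edges in the union of the sets `F 0, …, F (k - 1)`. -/
noncomputable def size {β : Type*} {k : ℕ} (F : Fin k → Set β) : ℕ := (⋃ i, F i).ncard

/-- The maximum size of a feasible solution of the `k`-forest problem in the (finite) graph `G`. -/
noncomputable def OPT {α β : Type*} (G : Graph α β) (k : ℕ) : ℕ :=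
  sSup {m | ∃ F : Fin k → Set β, IsFeasible G k F ∧ size F = m}

/-- For a finite graph, `OPT` is a maximum that is attained. -/
theorem isGreatest_OPT {α β : Type*} (G : Graph α β) (hE : G.edgeSet.Finite) (k : ℕ) :
    IsGreatest {m | ∃ F : Fin k → Set β, IsFeasible G k F ∧ size F = m} (OPT G k) := by
  have hbdd : BddAbove {m | ∃ F : Fin k → Set β, IsFeasible G k F ∧ size F = m} := by
    refine ⟨G.edgeSet.ncard, ?_⟩
    rintro m ⟨F, hF, rfl⟩
    exact Set.ncard_le_ncard (Set.iUnion_subset fun i => (hF.1 i).1) hE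
  refine ⟨Nat.sSup_mem ⟨size (fun _ : Fin k => (∅ : Set β)), fun _ => ∅, ⟨fun _ => ⟨by simp, ?_⟩, by simp⟩, rfl⟩ hbdd, fun m hm => le_csSup hbdd hm⟩
  rintro ⟨n, v, e, -, -, h⟩
  exact (h 0).1

/-- `head` is an orientation of the set `P` of edges of `G`: each edge of `P` is directed towards
the end `head e` of `e`. -/
def IsOrientation {α β : Type*} (G : Graph α β) (P : Set β) (head : β → α) : Prop :=
  ∀ e ∈ P, G.Inc e (head e)

/-- The number of edges of `P` with head `v`. -/
noncomputable def indeg {α β : Type*} (P : Set β) (head : β → α) (v : α) : ℕ :=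
  {e | e ∈ P ∧ head e = v}.ncard

/-- `P` is a set of edges of `G`, oriented by `head` with all indegrees at most `k`. -/
def IsIndegBounded {α β : Type*} (G : Graph α β) (k : ℕ) (P : Set β) (head : β → α) : Prop :=
  P ⊆ G.edgeSet ∧ IsOrientation G P head ∧ ∀ v ∈ G.vertexSet, indeg P head v ≤ k

/-- `(P, head)` is a possible output of `Pseudoforests(G, F, k)`: `P` contains `F` and is oriented
with all indegrees at most `k`, and `P` has the maximum number of edges among all edge sets that
contain `F` and have an orientation with all indegrees at most `k`. -/
def IsPseudoforestsOutput {α β : Type*} (G : Graph α β) (F : Set β) (k : ℕ)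
    (P : Set β) (head : β → α) : Prop :=
  F ⊆ P ∧ IsIndegBounded G k P head ∧
    ∀ (Q : Set β) (head' : β → α), F ⊆ Q → IsIndegBounded G k Q head' → Q.ncard ≤ P.ncard

/-- `H` is a feasible solution of the bounded indegree directed `k`-forest problem for the directed
graph `D` whose edges are directed by `head`. -/
def IsBoundedIndegreeFeasible {α β : Type*} (D : Graph α β) (head : β → α) (k : ℕ)
    (H : Fin k → Set β) : Prop :=
  IsFeasible D k H ∧ ∀ v ∈ D.vertexSet, indeg (⋃ i, H i) head v ≤ k

/-- `H` is a possible output of `BoundedIndegreeForests(D, k)`: an optimal solution of the bounded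
indegree directed `k`-forest problem for the directed graph `D`. -/
def IsBoundedIndegreeForestsOutput {α β : Type*} (D : Graph α β) (head : β → α) (k : ℕ)
    (H : Fin k → Set β) : Prop :=
  IsBoundedIndegreeFeasible D head k H ∧
    ∀ H' : Fin k → Set β, IsBoundedIndegreeFeasible D head k H' → size H' ≤ size H

/-- The number of edges in a spanning forest of the (finite) edge set `L`, that is, the maximum
number of edges of a forest contained in `L`. -/
noncomputable def rk {α β : Type*} (G : Graph α β) (L : Set β) : ℕ :=
  sSup {m | ∃ T : Set β, IsForest G T ∧ T ⊆ L ∧ T.ncard = m}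

/-- `L` is a clump of the edge set `F`: it is covered by `k` forests and `|L| = k * rk(L)`. -/
def IsClump {α β : Type*} (G : Graph α β) (k : ℕ) (F L : Set β) : Prop :=
  L ⊆ F ∧ (∃ T : Fin k → Set β, (∀ i, IsForest G (T i)) ∧ L ⊆ ⋃ i, T i) ∧
    L.ncard = k * rk G L

/-- A top clump of `F` is an inclusion-maximal clump of `F`. -/
def IsTopClump {α β : Type*} (G : Graph α β) (k : ℕ) (F L : Set β) : Prop :=
  Maximal (IsClump G k F) L

/-- `x` and `y` are joined by a (possibly trivial) walk that uses only edges of `L`. -/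
def ConnectedBy {α β : Type*} (G : Graph α β) (L : Set β) (x y : α) : Prop :=
  Relation.ReflTransGen (fun a b => ∃ e ∈ L, G.IsLink e a b) x y

/-- The graph `G` with its loops deleted. -/
def deleteLoops {α β : Type*} (G : Graph α β) : Graph α β :=
  G.deleteEdges {e | ∃ x, G.IsLoopAt e x}

/-- `G'` arises from `G` by contracting every connected component of the edge set `L` to a single
vertex and then deleting loops. The map `φ` names the vertices of `G'`: it identifies exactly the
vertices in a common component of `L`. Edges of `G'` keep their names from `G`. -/
def IsContraction {α β : Type*} (G : Graph α β) (L : Set β) (G' : Graph α β) : Prop :=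
  ∃ φ : α → α,
    (∀ x ∈ G.vertexSet, ∀ y ∈ G.vertexSet, φ x = φ y ↔ ConnectedBy G L x y) ∧
      G' = deleteLoops (G.map φ)

/-- One iteration of the while loop of the algorithm `Forests`, started with the graph `G` and the
solution `F`. It orients `F` with indegrees at most `k`, calls `Pseudoforests(G, F, k)` with
result `P`, calls `BoundedIndegreeForests(P, k)` with result `H`, finds the top clump `L` of `H`,
and contracts its components, which turns `(G, H)` into `(G', F')`. -/
def IsIteration {α β : Type*} (k : ℕ) (G : Graph α β) (F H : Fin k → Set β)
    (G' : Graph α β) (F' : Fin k → Set β) : Prop :=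
  ∃ (head₀ : β → α) (P : Set β) (head : β → α) (L : Set β),
    IsIndegBounded G k (⋃ i, F i) head₀ ∧
    IsPseudoforestsOutput G (⋃ i, F i) k P head ∧
    IsBoundedIndegreeForestsOutput (G.restrict P) head k H ∧
    IsTopClump G k (⋃ i, H i) L ∧
    IsContraction G L G' ∧
    ∀ i, F' i = H i ∩ G'.edgeSet

/-- `AtLoopStart k G₀ G F`: in some run of the algorithm on the input `(G₀, k)`, the current graph
and solution at the beginning of an iteration of the while loop are `G` and `F`. The algorithm
starts with `(G₀, (∅, …, ∅))`. The stopping condition of the loop is ignored, so that any number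
of iterations is allowed. -/
inductive AtLoopStart {α β : Type*} (k : ℕ) (G₀ : Graph α β) :
    Graph α β → (Fin k → Set β) → Prop
  | start : AtLoopStart k G₀ G₀ (fun _ => ∅)
  | next {G : Graph α β} {F H : Fin k → Set β} {G' : Graph α β} {F' : Fin k → Set β} :
      AtLoopStart k G₀ G F → IsIteration k G F H G' F' → AtLoopStart k G₀ G' F'

end KForest

/-! Equality: `H` has exactly |L| = k·rk(L) edges in the clump L, so each `H i ∩ L` spans L, and no
edge of `H` outside L is spanned by L. Contraction therefore removes |L| edges from `H`. It also
lowers the optimum by |L|: solutions of `G'` combine with the forests `H i ∩ L`, and some optimum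
contains the edges of `H`, so that L is a clump of it too (`IsContraction.OPT_add_ncard`).

Inequality: at the start of every iteration `F` has no nonempty clump, because a clump left after
contracting L would enlarge the top clump L. Write U for the edge set of `F`. An optimum containing
U can be oriented with indegrees at most k, so OPT ≤ |P|. Indegrees in P are already at most k, so
`H` is a maximum k-forest in P, and the matroid union theorem gives A ⊆ P with |H| = |P \ A| +
k·rk(A). A component of A of rank r has r + 1 vertices, hence at most kr + k edges. With d = kr - |U
∩ component| ≥ 1 (no clump), at most d + k ≤ (k+1)d of its edges lie outside U. Summing gives |A \
U| ≤ (k+1)(k·rk(A) - |U ∩ A|) (`ncard_sdiff_add_le`), and hence |P| - |U| ≤ (k+1)(|H| - |U|). -/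

namespace KForest

open Set

/-! ### Matroid union: exchange sequences and tight sets -/

/-- `(J, y)` is obtained from `(I, x)`, for some `x` outside of `⋃ i, I i`, by a sequence of
exchanges: an exchange puts the missing element into some `J i` and removes an element of the
fundamental circuit, which becomes the missing element. -/
inductive ExchangeReachable {β ι : Type*} [DecidableEq ι] (M : Matroid β) (I : ι → Set β) :
    (ι → Set β) → β → Prop
  | start (x : β) (hx : x ∈ M.E) (hxI : x ∉ ⋃ i, I i) : ExchangeReachable M I I x
  | step (J : ι → Set β) (y : β) (h : ExchangeReachable M I J y) (i : ι) (z : β)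
      (hz : z ∈ J i) (hzC : z ∈ M.fundCircuit y (J i)) :
      ExchangeReachable M I (Function.update J i (insert y (J i) \ {z})) z

/-- The sets `I i` are pairwise disjoint independent sets of `M`. -/
def IsDisjointIndep {β ι : Type*} (M : Matroid β) (I : ι → Set β) : Prop :=
  (∀ i, M.Indep (I i)) ∧ ∀ i j, i ≠ j → Disjoint (I i) (I j)

/-- The union of the sets `I i` is an inclusion-maximal union of pairwise disjoint independent
sets: no element can be added to it. -/
def IsUnionMaximal {β ι : Type*} (M : Matroid β) (I : ι → Set β) : Prop :=
  ∀ x ∈ M.E, x ∉ ⋃ i, I i → ∀ J : ι → Set β, IsDisjointIndep M J →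
    ⋃ i, J i ≠ insert x (⋃ i, I i)

section

variable {β ι : Type*} [DecidableEq ι] {M : Matroid β} {I J : ι → Set β} {x y : β}

theorem mem_iUnion_update {J : ι → Set β} {i : ι} {S : Set β} {a : β} :
    a ∈ ⋃ j, Function.update J i S j ↔ a ∈ S ∨ ∃ j, j ≠ i ∧ a ∈ J j := by
  simp only [mem_iUnion]
  constructor
  · rintro ⟨j, hj⟩
    by_cases h : j = i
    · subst h; left; simpa using hj
    · right; exact ⟨j, h, by simpa [h] using hj⟩
  · rintro (h | ⟨j, hji, h⟩)
    · exact ⟨i, by simpa using h⟩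
    · exact ⟨j, by simpa [hji] using h⟩

theorem IsDisjointIndep.update (hJ : IsDisjointIndep M J) {i : ι} {S : Set β} (hS : M.Indep S)
    (hd : ∀ j, j ≠ i → Disjoint S (J j)) : IsDisjointIndep M (Function.update J i S) := by
  refine ⟨fun j => ?_, fun j l hjl => ?_⟩
  · by_cases h : j = i
    · subst h; simpa using hS
    · simpa [h] using hJ.1 j
  · by_cases h : j = i
    · subst h
      simpa [Ne.symm hjl] using hd l (Ne.symm hjl)
    · by_cases h' : l = i
      · subst h'
        simpa [h] using (hd j h).symm
      · simpa [h, h'] using hJ.2 j l hjl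

/-- Otherwise y could join `J i`, and the new family would have union I ∪ {x}, against maximality.
-/
theorem IsUnionMaximal.mem_closure_of_insert_eq (hI : IsUnionMaximal M I)
    (hJ : IsDisjointIndep M J) (hx : x ∈ M.E) (hxI : x ∉ ⋃ i, I i) (hy : y ∈ M.E)
    (hyJ : y ∉ ⋃ i, J i) (hJI : insert y (⋃ i, J i) = insert x (⋃ i, I i)) (i : ι) :
    y ∈ M.closure (J i) := by
  by_contra hcl
  have hyi : ∀ j, y ∉ J j := fun j h => hyJ (mem_iUnion.2 ⟨j, h⟩)
  have hS : M.Indep (insert y (J i)) := ((hJ.1 i).insert_indep_iff_of_notMem (hyi i)).2 ⟨hy, hcl⟩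
  refine hI x hx hxI _ (hJ.update (i := i) hS fun j hji => ?_) ?_
  · rw [disjoint_insert_left]
    exact ⟨hyi j, hJ.2 i j hji.symm⟩
  · rw [← hJI]
    ext a
    rw [mem_iUnion_update]
    simp only [mem_insert_iff, mem_iUnion]
    constructor
    · rintro ((h | h) | ⟨j, -, h⟩)
      exacts [.inl h, .inr ⟨i, h⟩, .inr ⟨j, h⟩]
    · rintro (h | ⟨j, h⟩)
      · exact .inl (.inl h)
      · by_cases hji : j = i
        · subst hji; exact .inl (.inr h)
        · exact .inr ⟨j, hji, h⟩

/-- An exchange preserves the union together with the missing element. By maximality the missing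
element is thus always spanned by each `J i`, so the next fundamental circuit is a genuine circuit
and the swap keeps independence. -/
theorem ExchangeReachable.invariant (hI : IsDisjointIndep M I) (hmax : IsUnionMaximal M I)
    (h : ExchangeReachable M I J y) :
    IsDisjointIndep M J ∧ y ∈ M.E ∧ y ∉ ⋃ i, J i ∧
      ∃ x ∈ M.E, x ∉ ⋃ i, I i ∧ insert y (⋃ i, J i) = insert x (⋃ i, I i) := by
  induction h with
  | start x hx hxI => exact ⟨hI, hx, hxI, x, hx, hxI, rfl⟩
  | step J y h i z hz hzC ih =>
    obtain ⟨hJ, hyE, hyJ, x, hx, hxI, hJI⟩ := ih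
    have hyi : ∀ j, y ∉ J j := fun j h => hyJ (mem_iUnion.2 ⟨j, h⟩)
    have hcl := hmax.mem_closure_of_insert_eq hJ hx hxI hyE hyJ hJI i
    have hind := ((hJ.1 i).mem_fundCircuit_iff hcl (hyi i)).1 hzC
    have hzy : z ≠ y := fun e => hyi i (e ▸ hz)
    refine ⟨hJ.update hind fun j hji => ?_, (hJ.1 i).subset_ground hz, ?_, x, hx, hxI, ?_⟩
    · refine Disjoint.mono_left sdiff_subset ?_
      rw [disjoint_insert_left]
      exact ⟨hyi j, hJ.2 i j hji.symm⟩
    · rw [mem_iUnion_update]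
      rintro (h | ⟨j, hji, h⟩)
      · exact h.2 rfl
      · exact (hJ.2 i j hji.symm).le_bot ⟨hz, h⟩
    · rw [← hJI]
      ext a
      rw [mem_insert_iff, mem_iUnion_update]
      simp only [mem_insert_iff, mem_iUnion, mem_sdiff, mem_singleton_iff]
      constructor
      · rintro (h | (⟨h | h, -⟩ | ⟨j, -, h⟩))
        exacts [.inr ⟨i, h ▸ hz⟩, .inl h, .inr ⟨i, h⟩, .inr ⟨j, h⟩]
      · by_cases haz : a = z
        · exact fun _ => .inl haz
        rintro (h | ⟨j, h⟩)
        · exact .inr (.inl ⟨.inl h, haz⟩)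
        · by_cases hji : j = i
          · subst hji; exact .inr (.inl ⟨.inr h, haz⟩)
          · exact .inr (.inr ⟨j, hji, h⟩)

/-- The other elements of the fundamental circuit of y become missing after one more exchange, so
they are reachable as well. -/
theorem ExchangeReachable.mem_closure (hI : IsDisjointIndep M I) (hmax : IsUnionMaximal M I)
    (h : ExchangeReachable M I J y) (i : ι) :
    y ∈ M.closure (J i ∩ {a | ∃ K, ExchangeReachable M I K a}) := by
  obtain ⟨hJ, hyE, hyJ, x, hx, hxI, hJI⟩ := h.invariant hI hmax
  have hyi : y ∉ J i := fun h => hyJ (mem_iUnion.2 ⟨i, h⟩)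
  have hcl := hmax.mem_closure_of_insert_eq hJ hx hxI hyE hyJ hJI i
  have hC := (hJ.1 i).fundCircuit_isCircuit hcl hyi
  refine M.closure_subset_closure ?_
    (hC.mem_closure_sdiff_singleton_of_mem (M.mem_fundCircuit y (J i)))
  rw [M.fundCircuit_sdiff_eq_inter hyi]
  exact fun z hz => ⟨hz.2, _, ExchangeReachable.step J y h i z hz.2 hz.1⟩

/-- Each swap takes place along a circuit lying inside the reachable set, so it does not change the
span of the part of `J i` in that set. -/
theorem ExchangeReachable.closure_eq (hI : IsDisjointIndep M I) (hmax : IsUnionMaximal M I)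
    (h : ExchangeReachable M I J y) (i : ι) :
    M.closure (J i ∩ {a | ∃ K, ExchangeReachable M I K a}) =
      M.closure (I i ∩ {a | ∃ K, ExchangeReachable M I K a}) := by
  induction h with
  | start x hx hxI => rfl
  | step J y h j z hz hzC ih =>
    by_cases hij : i = j
    swap
    · simpa [hij] using ih
    subst hij
    rw [← ih]
    obtain ⟨hJ, hyE, hyJ, -⟩ := h.invariant hI hmax
    have hzA : z ∈ {a | ∃ K, ExchangeReachable M I K a} :=
      ⟨_, ExchangeReachable.step J y h i z hz hzC⟩
    have hyA : y ∈ {a | ∃ K, ExchangeReachable M I K a} := ⟨_, h⟩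
    have hyi : y ∉ J i := fun h => hyJ (mem_iUnion.2 ⟨i, h⟩)
    have hycl := h.mem_closure hI hmax i
    set A := {a | ∃ K, ExchangeReachable M I K a}
    have hIA : M.Indep (J i ∩ A) := (hJ.1 i).subset inter_subset_left
    have hset : Function.update J i (insert y (J i) \ {z}) i ∩ A =
        insert y (J i ∩ A) \ {z} := by
      simp only [Function.update_self]
      ext a
      simp only [mem_inter_iff, mem_sdiff, mem_insert_iff, mem_singleton_iff]
      constructor
      · rintro ⟨⟨h1 | h1, h2⟩, h3⟩
        exacts [⟨.inl h1, h2⟩, ⟨.inr ⟨h1, h3⟩, h2⟩]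
      · rintro ⟨h1 | h1, h2⟩
        exacts [⟨⟨.inl h1, h2⟩, h1 ▸ hyA⟩, ⟨⟨.inr h1.1, h2⟩, h1.2⟩]
    rw [hset]
    refine hIA.closure_insert_sdiff_eq_of_mem_closure hycl ?_
    have h1 : M.fundCircuit y (J i ∩ A) = M.fundCircuit y (J i) :=
      (hIA.fundCircuit_isCircuit hycl fun h => hyi h.1).eq_fundCircuit_of_subset (hJ.1 i)
        ((M.fundCircuit_subset_insert y _).trans (insert_subset_insert inter_subset_left))
    have hC := (hJ.1 i).fundCircuit_isCircuit (M.closure_subset_closure inter_subset_left hycl) hyi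
    rw [← h1] at hC hzC
    exact M.closure_subset_closure (sdiff_subset_sdiff_left (M.fundCircuit_subset_insert y _))
      (hC.mem_closure_sdiff_singleton_of_mem hzC)

/-- The tight set of the matroid union theorem: if the union of the disjoint independent sets
`I i` cannot be enlarged, then some set contains all elements outside of the union and is spanned
by each of the sets `I i`. -/
theorem exists_tight (hI : IsDisjointIndep M I) (hmax : IsUnionMaximal M I) :
    ∃ A ⊆ M.E, M.E \ ⋃ i, I i ⊆ A ∧ ∀ i, M.IsBasis (I i ∩ A) A := by
  have hAE : {a | ∃ K, ExchangeReachable M I K a} ⊆ M.E :=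
    fun a ⟨_, h⟩ => (h.invariant hI hmax).2.1
  refine ⟨_, hAE, fun a ha => ⟨I, .start a ha.1 ha.2⟩, fun i => ?_⟩
  refine ((hI.1 i).subset inter_subset_left).isBasis_of_subset_of_subset_closure
    inter_subset_right fun a ⟨K, h⟩ => ?_
  rw [← h.closure_eq hI hmax i]
  exact h.mem_closure hI hmax i

end

/-! ### Counting in disjoint independent sets -/

section

variable {β : Type*} {M : Matroid β}

theorem ncard_le_of_isBasis {J B X : Set β} (hX : X.Finite) (hJ : M.Indep J) (hJX : J ⊆ X)
    (hB : M.IsBasis B X) : J.ncard ≤ B.ncard := by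
  obtain ⟨J', hJ', hJJ'⟩ := hJ.subset_isBasis_of_subset hJX hB.subset_ground
  rw [ncard_def B, hB.encard_eq_encard hJ', ← ncard_def]
  exact ncard_le_ncard hJJ' (hX.subset hJ'.subset)

theorem isBasis_of_ncard_le {J B X : Set β} (hX : X.Finite) (hJ : M.Indep J) (hJX : J ⊆ X)
    (hB : M.IsBasis B X) (hle : B.ncard ≤ J.ncard) : M.IsBasis J X := by
  obtain ⟨J', hJ', hJJ'⟩ := hJ.subset_isBasis_of_subset hJX hB.subset_ground
  have := ncard_le_of_isBasis hX hJ'.indep hJ'.subset hB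
  rwa [eq_of_subset_of_ncard_le hJJ' (this.trans hle) (hX.subset hJ'.subset)]

theorem ncard_iUnion_inter {k : ℕ} {J : Fin k → Set β} (hJ : IsDisjointIndep M J)
    (hfin : M.E.Finite) (A : Set β) : ((⋃ i, J i) ∩ A).ncard = ∑ i, (J i ∩ A).ncard := by
  rw [iUnion_inter, ncard_iUnion_of_finite, finsum_eq_sum_of_fintype]
  · exact fun i => (hfin.subset (hJ.1 i).subset_ground).inter_of_left A
  · exact fun i j hij => (hJ.2 i j hij).mono inter_subset_left inter_subset_left

theorem IsDisjointIndep.iUnion_subset {ι : Type*} {J : ι → Set β} (hJ : IsDisjointIndep M J) :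
    ⋃ i, J i ⊆ M.E :=
  Set.iUnion_subset fun i => (hJ.1 i).subset_ground

theorem ncard_iUnion_inter_le {k : ℕ} {J : Fin k → Set β} (hJ : IsDisjointIndep M J)
    (hfin : M.E.Finite) {A B : Set β} (hB : M.IsBasis B A) :
    ((⋃ i, J i) ∩ A).ncard ≤ k * B.ncard := by
  rw [ncard_iUnion_inter hJ hfin]
  refine (Finset.sum_le_card_nsmul _ _ B.ncard fun i _ => ?_).trans (by simp)
  exact ncard_le_of_isBasis (hfin.subset hB.subset_ground) ((hJ.1 i).subset inter_subset_left)
    inter_subset_right hB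

/-- If disjoint independent sets contain `k` times the rank of `A` elements of `A`, then each of
them spans `A`. -/
theorem isBasis_inter_of_le_ncard {k : ℕ} {J : Fin k → Set β} (hJ : IsDisjointIndep M J)
    (hfin : M.E.Finite) {A B : Set β} (hB : M.IsBasis B A)
    (hle : k * B.ncard ≤ ((⋃ i, J i) ∩ A).ncard) (i : Fin k) : M.IsBasis (J i ∩ A) A := by
  have hAfin := hfin.subset hB.subset_ground
  have hi : ∀ i, (J i ∩ A).ncard ≤ B.ncard := fun i =>
    ncard_le_of_isBasis hAfin ((hJ.1 i).subset inter_subset_left) inter_subset_right hB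
  refine isBasis_of_ncard_le hAfin ((hJ.1 i).subset inter_subset_left) inter_subset_right hB ?_
  by_contra! hlt
  rw [ncard_iUnion_inter hJ hfin] at hle
  have := Finset.sum_lt_sum (fun j (_ : j ∈ Finset.univ) => hi j) ⟨i, Finset.mem_univ i, hlt⟩
  simp at this
  omega

theorem ncard_iUnion_of_isBasis {k : ℕ} {J : Fin k → Set β} (hJ : IsDisjointIndep M J)
    (hfin : M.E.Finite) {A B : Set β} (hB : M.IsBasis B A)
    (hJA : ∀ i, M.IsBasis (J i ∩ A) A) : ((⋃ i, J i) ∩ A).ncard = k * B.ncard := by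
  rw [ncard_iUnion_inter hJ hfin]
  have : ∀ i, (J i ∩ A).ncard = B.ncard := fun i => by
    rw [ncard_def, (hJA i).encard_eq_encard hB, ← ncard_def]
  simp [this]

/-- Disjoint independent sets whose union is inclusion-maximal have a union of maximum size. -/
theorem IsUnionMaximal.ncard_le {k : ℕ} {I J : Fin k → Set β} (hfin : M.E.Finite)
    (hI : IsDisjointIndep M I) (hmax : IsUnionMaximal M I) (hJ : IsDisjointIndep M J) :
    (⋃ i, J i).ncard ≤ (⋃ i, I i).ncard := by
  obtain ⟨A, hAE, hA, hIA⟩ := exists_tight hI hmax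
  obtain ⟨B, hB⟩ := M.exists_isBasis A
  have hIf := hfin.subset hI.iUnion_subset
  have hJf := hfin.subset hJ.iUnion_subset
  rw [← ncard_inter_add_ncard_sdiff_eq_ncard (⋃ i, J i) A hJf,
    ← ncard_inter_add_ncard_sdiff_eq_ncard (⋃ i, I i) A hIf,
    ncard_iUnion_of_isBasis hI hfin hB hIA]
  -- Inside A the family I attains the upper bound; outside A its union is everything.
  refine add_le_add (ncard_iUnion_inter_le hJ hfin hB) (ncard_le_ncard (fun a ha => ?_) hIf.sdiff)
  refine ⟨?_, ha.2⟩
  by_contra h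
  exact ha.2 (hA ⟨hJ.iUnion_subset ha.1, h⟩)

/-- Disjoint independent sets extend to ones with an inclusion-maximal union. -/
theorem IsDisjointIndep.exists_isUnionMaximal {k : ℕ} {I : Fin k → Set β} (hfin : M.E.Finite)
    (hI : IsDisjointIndep M I) :
    ∃ J : Fin k → Set β, IsDisjointIndep M J ∧ ⋃ i, I i ⊆ ⋃ i, J i ∧ IsUnionMaximal M J := by
  have hfs : {U : Set β | ∃ J : Fin k → Set β, IsDisjointIndep M J ∧ ⋃ i, J i = U}.Finite := by
    refine hfin.finite_subsets.subset ?_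
    rintro U ⟨J, hJ, rfl⟩
    exact hJ.iUnion_subset
  obtain ⟨U, hIU, hU⟩ := hfs.exists_le_maximal ⟨I, hI, rfl⟩
  obtain ⟨J, hJ, rfl⟩ := hU.prop
  refine ⟨J, hJ, hIU, fun x _ hxJ K hK hKJ => hxJ ?_⟩
  have := hU.le_of_ge ⟨K, hK, rfl⟩ (hKJ ▸ subset_insert _ _)
  rw [hKJ] at this
  exact this (mem_insert _ _)

end

/-! ### The cycle matroid via incidence vectors over the two-element field -/

section

variable {α β : Type*} {G : Graph α β}

/-- The column of the edge `e` in the incidence matrix of `G` over the field with two elements. -/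
noncomputable def incidenceVec (G : Graph α β) (e : β) : α →₀ ZMod 2 :=
  open Classical in
  -- In characteristic two the order of the ends does not matter and a loop gets the zero vector.
  if h : ∃ x y, G.IsLink e x y then
    Finsupp.single h.choose 1 + Finsupp.single h.choose_spec.choose 1 else 0

theorem incidenceVec_eq {e : β} {x y : α} (h : G.IsLink e x y) :
    incidenceVec G e = Finsupp.single x 1 + Finsupp.single y 1 := by
  have hex : ∃ x y, G.IsLink e x y := ⟨x, y, h⟩
  rw [incidenceVec, dif_pos hex]
  obtain ⟨h1, h2⟩ | ⟨h1, h2⟩ := hex.choose_spec.choose_spec.eq_and_eq_or_eq_and_eq h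
  · exact congrArg₂ (fun a b => Finsupp.single a 1 + Finsupp.single b 1) h1 h2
  · rw [add_comm (Finsupp.single x 1)]
    exact congrArg₂ (fun a b => Finsupp.single a 1 + Finsupp.single b 1) h1 h2

theorem incidenceVec_of_notMem {e : β} (h : e ∉ G.edgeSet) : incidenceVec G e = 0 := by
  rw [incidenceVec, dif_neg]
  rintro ⟨x, y, hxy⟩
  exact h hxy.edge_mem

theorem zmod_two_add_self {W : Type*} [AddCommGroup W] [Module (ZMod 2) W] (w : W) :
    w + w = 0 := by
  rw [← two_smul (ZMod 2) w, show (2 : ZMod 2) = 0 from rfl, zero_smul]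

theorem ConnectedBy.add_mem_span {L : Set β} {x y : α} (h : ConnectedBy G L x y) :
    (Finsupp.single x 1 + Finsupp.single y 1 : α →₀ ZMod 2) ∈
      Submodule.span (ZMod 2) (incidenceVec G '' L) := by
  induction h with
  | refl => rw [zmod_two_add_self]; exact zero_mem _
  | @tail b c _ hbc ih =>
    obtain ⟨e, heL, he⟩ := hbc
    have h1 : (Finsupp.single x 1 + Finsupp.single c 1 : α →₀ ZMod 2) =
        (Finsupp.single x 1 + Finsupp.single b 1) + incidenceVec G e := by
      rw [incidenceVec_eq he]
      have := zmod_two_add_self (Finsupp.single b 1 : α →₀ ZMod 2)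
      rw [add_assoc, ← add_assoc (Finsupp.single b 1), this, zero_add]
    rw [h1]
    exact add_mem ih (Submodule.subset_span ⟨e, heL, rfl⟩)

theorem ConnectedBy.symm {L : Set β} {x y : α} (h : ConnectedBy G L x y) :
    ConnectedBy G L y x := by
  induction h with
  | refl => exact .refl
  | tail _ hbc ih =>
    obtain ⟨e, heL, he⟩ := hbc
    exact .head ⟨e, heL, he.symm⟩ ih

/-- The linear functional that adds up the coordinates in `C`. -/
noncomputable def sumOn (C : Set α) : (α →₀ ZMod 2) →ₗ[ZMod 2] ZMod 2 :=
  Finsupp.linearCombination (ZMod 2) (C.indicator 1)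

theorem sumOn_single (C : Set α) (x : α) : sumOn C (Finsupp.single x 1) = C.indicator 1 x := by
  simp [sumOn]

/-- The sum of the coordinates over the component of x vanishes on every edge of L, but is 1 on this
vector if y lies elsewhere. -/
theorem connectedBy_of_add_mem_span {L : Set β} {x y : α}
    (h : (Finsupp.single x 1 + Finsupp.single y 1 : α →₀ ZMod 2) ∈
      Submodule.span (ZMod 2) (incidenceVec G '' L)) : ConnectedBy G L x y := by
  classical
  have hle : Submodule.span (ZMod 2) (incidenceVec G '' L) ≤
      LinearMap.ker (sumOn {z | ConnectedBy G L x z}) := by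
    rw [Submodule.span_le]
    rintro _ ⟨e, heL, rfl⟩
    rw [SetLike.mem_coe, LinearMap.mem_ker]
    by_cases he : e ∈ G.edgeSet
    · obtain ⟨a, b, hab⟩ := Graph.exists_isLink_of_mem_edgeSet he
      rw [incidenceVec_eq hab, map_add, sumOn_single, sumOn_single]
      have : ConnectedBy G L x a ↔ ConnectedBy G L x b :=
        ⟨fun h => .tail h ⟨e, heL, hab⟩, fun h => .tail h ⟨e, heL, hab.symm⟩⟩
      by_cases h : ConnectedBy G L x a
      · simp only [indicator, mem_ofPred_eq, h, this.1 h, if_true]; rfl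
      · simp [indicator, h, mt this.2 h]
    · rw [incidenceVec_of_notMem he, map_zero]
  have := hle h
  rw [LinearMap.mem_ker, map_add, sumOn_single, sumOn_single] at this
  by_contra hxy
  have hxx : ConnectedBy G L x x := .refl
  simp [indicator, hxx, hxy] at this

theorem exists_path {L : Set β} {x y : α} (h : ConnectedBy G L x y) :
    ∃ (n : ℕ) (v : ℕ → α), InjOn v (Iic n) ∧ v 0 = x ∧ v n = y ∧
      ∀ i < n, ∃ e ∈ L, G.IsLink e (v i) (v (i + 1)) := by
  let S : SimpleGraph α := SimpleGraph.fromRel (fun a b => ∃ e ∈ L, G.IsLink e a b)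
  have hS : ∀ a b, S.Adj a b → ∃ e ∈ L, G.IsLink e a b := by
    rintro a b ⟨-, h | ⟨e, he, h⟩⟩
    exacts [h, ⟨e, he, h.symm⟩]
  have hr : S.Reachable x y := by
    induction h with
    | refl => exact .refl _
    | @tail b c _ hbc ih =>
      by_cases hne : b = c
      · exact hne ▸ ih
      · exact ih.trans (SimpleGraph.Adj.reachable ⟨hne, .inl hbc⟩)
  obtain ⟨p, hp⟩ := hr.exists_isPath
  refine ⟨p.length, p.getVert, hp.getVert_injOn, p.getVert_zero, p.getVert_length, fun i hi => ?_⟩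
  exact hS _ _ (p.adj_getVert_succ hi)

theorem exists_cycle_of_connectedBy {T : Set β} {e₀ : β} {x y : α} (he₀ : e₀ ∈ T)
    (hxy : G.IsLink e₀ x y) (h : ConnectedBy G (T \ {e₀}) x y) :
    ∃ (n : ℕ) (v : Fin (n + 1) → α) (e : Fin (n + 1) → β),
      Function.Injective v ∧ Function.Injective e ∧
        ∀ i, e i ∈ T ∧ G.IsLink (e i) (v i) (v (i + 1)) := by
  obtain ⟨n, v, hv, hv0, hvn, hl⟩ := exists_path h
  have : Nonempty β := ⟨e₀⟩
  choose! f hfL hfl using hl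
  have hinj : ∀ i j, i ≤ n → j ≤ n → v i = v j → i = j := fun i j hi hj h => hv hi hj h
  refine ⟨n, fun i => v i, fun i => if (i : ℕ) < n then f i else e₀, ?_, ?_, ?_⟩
  · intro i j hij
    exact Fin.ext (hinj _ _ (by omega) (by omega) hij)
  · intro i j hij
    simp only at hij
    have hi := i.2
    have hj := j.2
    apply Fin.ext
    split_ifs at hij with h1 h2 h2
    -- A repeated path edge has the same ends; the swapped case would force i = j + 1 and i + 1 = j.
    · have := hfl _ h1
      rw [hij] at this
      obtain ⟨h3, -⟩ | ⟨h3, h4⟩ := this.eq_and_eq_or_eq_and_eq (hfl _ h2)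
      · exact hinj _ _ (by omega) (by omega) h3
      · have := hinj _ _ (by omega) (by omega) h3
        have := hinj _ _ (by omega) (by omega) h4
        omega
    · exact absurd hij (hfL _ h1).2
    · exact absurd hij.symm (hfL _ h2).2
    · omega
  · intro i
    have hi := i.2
    simp only
    split_ifs with h1
    · refine ⟨(hfL _ h1).1, ?_⟩
      have : ((i + 1 : Fin (n + 1)) : ℕ) = i + 1 := by
        rw [Fin.val_add_one_of_lt']; omega
      rw [this]
      exact hfl _ h1
    · have h2 : i = Fin.last n := Fin.ext (by simp; omega)
      subst h2
      simpa [he₀, hv0, hvn] using hxy.symm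

/-- If the vector of an edge is spanned by the others, its ends are joined by a path avoiding it,
which closes to a cycle. Conversely the vectors along a cycle sum to zero. -/
theorem isForest_iff {T : Set β} :
    IsForest G T ↔ T ⊆ G.edgeSet ∧ LinearIndepOn (ZMod 2) (incidenceVec G) T := by
  refine and_congr_right fun hT => ⟨fun hno => ?_, ?_⟩
  · rw [linearIndepOn_iff_notMem_span]
    intro e he hmem
    obtain ⟨x, y, hxy⟩ := Graph.exists_isLink_of_mem_edgeSet (hT he)
    rw [incidenceVec_eq hxy] at hmem
    exact hno (exists_cycle_of_connectedBy he hxy (connectedBy_of_add_mem_span hmem))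
  · rintro hli ⟨n, v, e, -, he, hl⟩
    have h1 : LinearIndependent (ZMod 2) fun i => incidenceVec G (e i) :=
      hli.comp (fun i => (⟨e i, (hl i).1⟩ : T)) fun i j hij => he (by simpa using hij)
    rw [Fintype.linearIndependent_iff] at h1
    have h2 := h1 (fun _ => 1) (by
      simp only [one_smul, fun i => incidenceVec_eq (hl i).2, Finset.sum_add_distrib]
      -- The cyclic shift permutes the indices, so every vertex of the cycle is counted twice.
      have := Equiv.sum_comp (Equiv.addRight (1 : Fin (n + 1)))
        (fun i => (Finsupp.single (v i) 1 : α →₀ ZMod 2))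
      simp only [Equiv.coe_addRight] at this
      rw [this]
      exact zmod_two_add_self _) 0
    exact one_ne_zero h2

theorem finrank_span_incidenceVec {T : Set β} (hT : T.Finite)
    (h : LinearIndepOn (ZMod 2) (incidenceVec G) T) :
    Module.finrank (ZMod 2) (Submodule.span (ZMod 2) (incidenceVec G '' T)) = T.ncard := by
  have := hT.fintype
  rw [image_eq_range, finrank_span_eq_card h, ncard_eq_toFinset_card', toFinset_card]

theorem finiteDimensional_span_incidenceVec {T : Set β} (hT : T.Finite) :
    FiniteDimensional (ZMod 2) (Submodule.span (ZMod 2) (incidenceVec G '' T)) :=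
  FiniteDimensional.span_of_finite _ (hT.image _)

/-- The cycle matroid of a finite graph, whose independent sets are the forests. -/
noncomputable def cycleMatroid (G : Graph α β) (hE : G.edgeSet.Finite) : Matroid β :=
  (IndepMatroid.ofFinite hE (IsForest G)
    (isForest_iff.2 ⟨empty_subset _, linearIndepOn_empty _ _⟩)
    (fun I J hJ hIJ => by
      rw [isForest_iff] at hJ ⊢
      exact ⟨hIJ.trans hJ.1, hJ.2.mono hIJ⟩)
    (fun I J hI hJ hlt => by
      rw [isForest_iff] at hI hJ
      have hIf := hE.subset hI.1
      have := finiteDimensional_span_incidenceVec (G := G) hIf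
      by_contra! hcon
      -- If no edge of J extends I, the span of J lies in that of I, contradicting |I| < |J|.
      have hle : Submodule.span (ZMod 2) (incidenceVec G '' J) ≤
          Submodule.span (ZMod 2) (incidenceVec G '' I) := by
        rw [Submodule.span_le]
        rintro _ ⟨e, heJ, rfl⟩
        by_contra hmem
        have heI : e ∉ I := fun h => hmem (Submodule.subset_span ⟨e, h, rfl⟩)
        exact hcon e heJ heI (isForest_iff.2 ⟨insert_subset (hJ.1 heJ) hI.1, hI.2.insert hmem⟩)
      have := Submodule.finrank_mono hle
      rw [finrank_span_incidenceVec hIf hI.2,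
        finrank_span_incidenceVec (hE.subset hJ.1) hJ.2] at this
      omega)
    (fun I hI => hI.1)).matroid

variable {hE : G.edgeSet.Finite}

@[simp] theorem cycleMatroid_ground : (cycleMatroid G hE).E = G.edgeSet := rfl

@[simp] theorem cycleMatroid_indep {T : Set β} : (cycleMatroid G hE).Indep T ↔ IsForest G T := by
  simp [cycleMatroid]

theorem isFeasible_iff {k : ℕ} {F : Fin k → Set β} :
    IsFeasible G k F ↔ IsDisjointIndep (cycleMatroid G hE) F := by
  simp [IsFeasible, IsDisjointIndep]

theorem rk_eq_ncard {L B : Set β} (hB : (cycleMatroid G hE).IsBasis B L) : rk G L = B.ncard := by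
  refine IsGreatest.csSup_eq ⟨⟨B, cycleMatroid_indep.1 hB.indep, hB.subset, rfl⟩, ?_⟩
  rintro m ⟨T, hT, hTL, rfl⟩
  exact ncard_le_of_isBasis (hE.subset hB.subset_ground) (cycleMatroid_indep.2 hT) hTL hB

theorem span_eq_of_isBasis {L B : Set β} (hB : (cycleMatroid G hE).IsBasis B L) :
    Submodule.span (ZMod 2) (incidenceVec G '' B) =
      Submodule.span (ZMod 2) (incidenceVec G '' L) := by
  refine le_antisymm (Submodule.span_mono (image_mono hB.subset)) ?_
  rw [Submodule.span_le]
  rintro _ ⟨e, heL, rfl⟩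
  by_contra hmem
  have heB : e ∉ B := fun h => hmem (Submodule.subset_span ⟨e, h, rfl⟩)
  have hBi := isForest_iff.1 (cycleMatroid_indep.1 hB.indep)
  have := hB.mem_of_insert_indep heL (cycleMatroid_indep.2 (isForest_iff.2
    ⟨insert_subset (hB.subset_ground heL) hBi.1, hBi.2.insert hmem⟩))
  exact heB this

theorem rk_eq_finrank {L : Set β} (hE : G.edgeSet.Finite) (hL : L ⊆ G.edgeSet) :
    rk G L = Module.finrank (ZMod 2) (Submodule.span (ZMod 2) (incidenceVec G '' L)) := by
  obtain ⟨B, hB⟩ := (cycleMatroid G hE).exists_isBasis L hL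
  have hBi := isForest_iff.1 (cycleMatroid_indep.1 hB.indep)
  rw [rk_eq_ncard hB, ← span_eq_of_isBasis hB,
    finrank_span_incidenceVec (hE.subset hBi.1) hBi.2]

end

/-! ### Contraction in terms of spans and forests -/

section

variable {α β : Type*} {G G' : Graph α β} {L : Set β} {φ : α → α}

theorem incidenceVec_mem_supported (G : Graph α β) (e : β) :
    incidenceVec G e ∈ Finsupp.supported (ZMod 2) (ZMod 2) G.vertexSet := by
  by_cases he : e ∈ G.edgeSet
  · obtain ⟨x, y, hxy⟩ := Graph.exists_isLink_of_mem_edgeSet he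
    rw [incidenceVec_eq hxy]
    exact add_mem (Finsupp.single_mem_supported _ _ hxy.left_mem)
      (Finsupp.single_mem_supported _ _ hxy.right_mem)
  · rw [incidenceVec_of_notMem he]
    exact zero_mem _

theorem deleteLoops_map_isLink {e : β} {a b : α} :
    (deleteLoops (G.map φ)).IsLink e a b ↔
      ∃ x y, G.IsLink e x y ∧ φ x = a ∧ φ y = b ∧ φ x ≠ φ y := by
  simp only [deleteLoops, Graph.deleteEdges_isLink, mem_ofPred_eq, Graph.map_isLink]
  constructor
  · rintro ⟨⟨x, y, hxy, rfl, rfl⟩, hno⟩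
    refine ⟨x, y, hxy, rfl, rfl, fun h => hno ⟨φ x, x, y, hxy, rfl, h.symm⟩⟩
  · rintro ⟨x, y, hxy, rfl, rfl, hne⟩
    refine ⟨⟨x, y, hxy, rfl, rfl⟩, ?_⟩
    rintro ⟨z, u, v, huv, h1, h2⟩
    obtain ⟨h3, h4⟩ | ⟨h3, h4⟩ := hxy.eq_and_eq_or_eq_and_eq huv
    · exact hne (by rw [h3, h4, h1, h2])
    · exact hne (by rw [h3, h4, h1, h2])

theorem mem_deleteLoops_map_edgeSet {e : β} {x y : α} (h : G.IsLink e x y) :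
    e ∈ (deleteLoops (G.map φ)).edgeSet ↔ φ x ≠ φ y := by
  rw [Graph.edge_mem_iff_exists_isLink]
  simp only [deleteLoops_map_isLink]
  constructor
  · rintro ⟨_, _, u, v, huv, -, -, hne⟩
    obtain ⟨h3, h4⟩ | ⟨h3, h4⟩ := h.eq_and_eq_or_eq_and_eq huv
    · rwa [h3, h4]
    · rw [h3, h4]; exact hne.symm
  · exact fun hne => ⟨_, _, x, y, h, rfl, rfl, hne⟩

theorem IsContraction.edgeSet_subset (h : IsContraction G L G') : G'.edgeSet ⊆ G.edgeSet := by
  obtain ⟨φ, -, rfl⟩ := h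
  intro e he
  obtain ⟨a, b, hab⟩ := Graph.exists_isLink_of_mem_edgeSet he
  obtain ⟨x, y, hxy, -⟩ := deleteLoops_map_isLink.1 hab
  exact hxy.edge_mem

theorem IsContraction.loopless (h : IsContraction G L G') : G'.Loopless := by
  obtain ⟨φ, -, rfl⟩ := h
  refine ⟨fun e a ha => ?_⟩
  obtain ⟨x, y, -, h1, h2, hne⟩ := deleteLoops_map_isLink.1 ha
  exact hne (h1.trans h2.symm)

theorem IsContraction.finite_vertexSet (h : IsContraction G L G') (hV : G.vertexSet.Finite) :
    G'.vertexSet.Finite := by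
  obtain ⟨φ, -, rfl⟩ := h
  exact hV.image φ

theorem incidenceVec_deleteLoops_map {e : β} (he : e ∈ (deleteLoops (G.map φ)).edgeSet) :
    incidenceVec (deleteLoops (G.map φ)) e =
      Finsupp.lmapDomain (ZMod 2) (ZMod 2) φ (incidenceVec G e) := by
  obtain ⟨a, b, hab⟩ := Graph.exists_isLink_of_mem_edgeSet he
  obtain ⟨x, y, hxy, rfl, rfl, -⟩ := deleteLoops_map_isLink.1 hab
  rw [incidenceVec_eq hab, incidenceVec_eq hxy, map_add]
  simp [Finsupp.lmapDomain_apply]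

/-- Let s pick a representative of each class. A vertex x is connected by L to s(φ x), so w + s(φ w)
lies in the span of L for every w supported on the vertices. -/
theorem mem_span_of_lmapDomain_eq_zero
    (hφ : ∀ x ∈ G.vertexSet, ∀ y ∈ G.vertexSet, φ x = φ y ↔ ConnectedBy G L x y)
    {w : α →₀ ZMod 2} (hw : w ∈ Finsupp.supported (ZMod 2) (ZMod 2) G.vertexSet)
    (h0 : Finsupp.lmapDomain (ZMod 2) (ZMod 2) φ w = 0) :
    w ∈ Submodule.span (ZMod 2) (incidenceVec G '' L) := by
  rcases isEmpty_or_nonempty α with hα | hα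
  · rw [Subsingleton.elim w 0]; exact zero_mem _
  set s := Function.invFunOn φ G.vertexSet
  have hs : ∀ x ∈ G.vertexSet, s (φ x) ∈ G.vertexSet ∧ φ (s (φ x)) = φ x := fun x hx =>
    ⟨Function.invFunOn_mem ⟨x, hx, rfl⟩, Function.invFunOn_eq ⟨x, hx, rfl⟩⟩
  have hle : Finsupp.supported (ZMod 2) (ZMod 2) G.vertexSet ≤
      (Submodule.span (ZMod 2) (incidenceVec G '' L)).comap
        (LinearMap.id + (Finsupp.lmapDomain (ZMod 2) (ZMod 2) s).comp
          (Finsupp.lmapDomain (ZMod 2) (ZMod 2) φ)) := by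
    rw [Finsupp.supported_eq_span_single, Submodule.span_le]
    rintro _ ⟨x, hx, rfl⟩
    have := ((hφ x hx _ (hs x hx).1).1 (hs x hx).2.symm).add_mem_span
    simpa [Finsupp.lmapDomain_apply] using this
  have := hle hw
  simpa [h0] using this

theorem lmapDomain_eq_zero_of_mem_span
    (hφ : ∀ x ∈ G.vertexSet, ∀ y ∈ G.vertexSet, φ x = φ y ↔ ConnectedBy G L x y)
    {w : α →₀ ZMod 2} (hw : w ∈ Submodule.span (ZMod 2) (incidenceVec G '' L)) :
    Finsupp.lmapDomain (ZMod 2) (ZMod 2) φ w = 0 := by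
  rw [← LinearMap.mem_ker]
  revert w
  rw [← SetLike.le_def, Submodule.span_le]
  rintro _ ⟨e, heL, rfl⟩
  rw [SetLike.mem_coe, LinearMap.mem_ker]
  by_cases he : e ∈ G.edgeSet
  · obtain ⟨x, y, hxy⟩ := Graph.exists_isLink_of_mem_edgeSet he
    have : φ x = φ y := (hφ x hxy.left_mem y hxy.right_mem).2 (.single ⟨e, heL, hxy⟩)
    rw [incidenceVec_eq hxy, map_add]
    simp only [Finsupp.lmapDomain_apply, Finsupp.mapDomain_single, this]
    exact zmod_two_add_self _
  · rw [incidenceVec_of_notMem he, map_zero]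

theorem mem_closure_iff {hE : G.edgeSet.Finite} (hL : L ⊆ G.edgeSet) {e : β}
    (he : e ∈ G.edgeSet) : e ∈ (cycleMatroid G hE).closure L ↔
      incidenceVec G e ∈ Submodule.span (ZMod 2) (incidenceVec G '' L) := by
  obtain ⟨B, hB⟩ := (cycleMatroid G hE).exists_isBasis L hL
  have hBi := isForest_iff.1 (cycleMatroid_indep.1 hB.indep)
  rw [← hB.closure_eq_closure, ← span_eq_of_isBasis hB]
  by_cases heB : e ∈ B
  · exact iff_of_true ((cycleMatroid G hE).mem_closure_of_mem heB hB.indep.subset_ground)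
      (Submodule.subset_span ⟨e, heB, rfl⟩)
  · rw [← not_iff_not, hB.indep.notMem_closure_iff_of_notMem heB he, cycleMatroid_indep,
      isForest_iff, linearIndepOn_insert heB]
    simp [insert_subset_iff, he, hBi.1, hBi.2]

/-- An edge becomes a loop exactly when L connects its ends, that is, when L spans it. -/
theorem IsContraction.mem_edgeSet_iff {hE : G.edgeSet.Finite} (h : IsContraction G L G')
    (hL : L ⊆ G.edgeSet) {e : β} :
    e ∈ G'.edgeSet ↔ e ∈ G.edgeSet ∧ e ∉ (cycleMatroid G hE).closure L := by
  refine ⟨fun he => ⟨h.edgeSet_subset he, fun hcl => ?_⟩, fun ⟨he, hcl⟩ => ?_⟩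
  · have heG := h.edgeSet_subset he
    obtain ⟨φ, hφ, rfl⟩ := h
    obtain ⟨x, y, hxy⟩ := Graph.exists_isLink_of_mem_edgeSet heG
    rw [mem_deleteLoops_map_edgeSet hxy] at he
    rw [mem_closure_iff hL heG, incidenceVec_eq hxy] at hcl
    exact he ((hφ x hxy.left_mem y hxy.right_mem).2 (connectedBy_of_add_mem_span hcl))
  · obtain ⟨φ, hφ, rfl⟩ := h
    obtain ⟨x, y, hxy⟩ := Graph.exists_isLink_of_mem_edgeSet he
    rw [mem_deleteLoops_map_edgeSet hxy]
    intro hxy'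
    rw [mem_closure_iff hL he, incidenceVec_eq hxy] at hcl
    exact hcl ((hφ x hxy.left_mem y hxy.right_mem).1 hxy').add_mem_span

/-- Forests of the contraction by `L` are the sets that form a forest together with a spanning
forest of `L`. -/
theorem IsContraction.isForest_iff {hE : G.edgeSet.Finite} (h : IsContraction G L G')
    {T B : Set β} (hT : T ⊆ G'.edgeSet) (hB : (cycleMatroid G hE).IsBasis B L) :
    IsForest G' T ↔ IsForest G (T ∪ B) := by
  have hL : L ⊆ G.edgeSet := hB.subset_ground
  have hdj : Disjoint T B := by
    rw [disjoint_left]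
    intro e heT heB
    exact ((h.mem_edgeSet_iff (hE := hE) hL).1 (hT heT)).2
      ((cycleMatroid G hE).mem_closure_of_mem (hB.subset heB) hL)
  have hBi := KForest.isForest_iff.1 (cycleMatroid_indep.1 hB.indep)
  have hTG := hT.trans h.edgeSet_subset
  obtain ⟨φ, hφ, rfl⟩ := h
  rw [KForest.isForest_iff, KForest.isForest_iff, and_iff_right hT,
    and_iff_right (union_subset hTG hBi.1), linearIndepOn_union_iff hdj, span_eq_of_isBasis hB,
    and_iff_right hBi.2]
  -- On vectors supported on the vertices, the kernel of the contraction map is the span of L.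
  have hdisj : Disjoint (Submodule.span (ZMod 2) (incidenceVec G '' T))
      (LinearMap.ker (Finsupp.lmapDomain (ZMod 2) (ZMod 2) φ)) ↔
      Disjoint (Submodule.span (ZMod 2) (incidenceVec G '' T))
        (Submodule.span (ZMod 2) (incidenceVec G '' L)) := by
    refine ⟨fun hd => hd.mono_right fun w hw => lmapDomain_eq_zero_of_mem_span hφ hw, fun hd => ?_⟩
    rw [Submodule.disjoint_def] at hd ⊢
    intro w hwT hw
    refine hd w hwT (mem_span_of_lmapDomain_eq_zero hφ ?_ hw)
    refine Submodule.span_le.2 ?_ hwT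
    rintro _ ⟨e, -, rfl⟩
    exact incidenceVec_mem_supported G e
  have hcongr : LinearIndepOn (ZMod 2) (incidenceVec (deleteLoops (G.map φ))) T ↔
      LinearIndepOn (ZMod 2)
        (Finsupp.lmapDomain (ZMod 2) (ZMod 2) φ ∘ incidenceVec G) T :=
    linearIndepOn_congr fun e he => incidenceVec_deleteLoops_map (hT he)
  rw [hcongr, ← hdisj, image_eq_range]
  constructor
  · intro hi
    exact ⟨LinearIndependent.of_comp _ hi, Submodule.range_ker_disjoint hi⟩
  · rintro ⟨hi, hd⟩
    exact hi.map hd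

end

/-! ### Contracting a clump -/

section

variable {α β : Type*} {G G' : Graph α β} {k : ℕ} {L : Set β} {H : Fin k → Set β}

theorem isBasis_inter {hE : G.edgeSet.Finite}
    (hH : IsFeasible G k H) (hL : IsClump G k (⋃ i, H i) L) (i : Fin k) :
    (cycleMatroid G hE).IsBasis (H i ∩ L) L := by
  rw [isFeasible_iff (hE := hE)] at hH
  obtain ⟨B, hB⟩ := (cycleMatroid G hE).exists_isBasis L (hL.1.trans hH.iUnion_subset)
  refine isBasis_inter_of_le_ncard hH hE hB ?_ i
  rw [inter_eq_self_of_subset_right hL.1, hL.2.2, rk_eq_ncard hB]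

/-- The closure has the same rank as L, so `H` has at most k·rk(L) = |L| edges in it. -/
theorem iUnion_inter_closure_eq {hE : G.edgeSet.Finite}
    (hH : IsFeasible G k H) (hL : IsClump G k (⋃ i, H i) L) :
    (⋃ i, H i) ∩ (cycleMatroid G hE).closure L = L := by
  rw [isFeasible_iff (hE := hE)] at hH
  have hLE := hL.1.trans hH.iUnion_subset
  obtain ⟨B, hB⟩ := (cycleMatroid G hE).exists_isBasis L hLE
  refine (eq_of_subset_of_ncard_le
    (subset_inter hL.1 ((cycleMatroid G hE).subset_closure L hLE)) ?_
    ((hE.subset hH.iUnion_subset).inter_of_left _)).symm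
  rw [hL.2.2, rk_eq_ncard hB]
  exact ncard_iUnion_inter_le hH hE hB.isBasis_closure_right

theorem IsContraction.inter_edgeSet (hE : G.edgeSet.Finite) (h : IsContraction G L G')
    (hH : IsFeasible G k H) (hL : IsClump G k (⋃ i, H i) L) (i : Fin k) :
    H i ∩ G'.edgeSet = H i \ L := by
  have hLE := hL.1.trans ((isFeasible_iff (hE := hE)).1 hH).iUnion_subset
  have hcl := iUnion_inter_closure_eq (hE := hE) hH hL
  ext e
  simp only [mem_inter_iff, mem_sdiff, h.mem_edgeSet_iff (hE := hE) hLE]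
  refine and_congr_right fun he => ⟨fun h' heL =>
    h'.2 ((cycleMatroid G hE).mem_closure_of_mem heL hLE), fun heL =>
    ⟨(hH.1 i).1 he, fun hecl => heL ?_⟩⟩
  rw [← hcl]
  exact ⟨mem_iUnion.2 ⟨i, he⟩, hecl⟩

theorem IsContraction.isFeasible_sdiff (hE : G.edgeSet.Finite) (h : IsContraction G L G')
    (hH : IsFeasible G k H) (hL : IsClump G k (⋃ i, H i) L) :
    IsFeasible G' k (fun i => H i \ L) := by
  refine ⟨fun i => ?_, fun i j hij => (hH.2 i j hij).mono sdiff_subset sdiff_subset⟩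
  have hsub : H i \ L ⊆ G'.edgeSet := by
    rw [← h.inter_edgeSet hE hH hL i]
    exact inter_subset_right
  rw [h.isForest_iff (hE := hE) hsub (isBasis_inter hH hL i), sdiff_union_inter]
  exact hH.1 i

theorem size_sdiff (hE : G.edgeSet.Finite) (hH : IsFeasible G k H) (hL : L ⊆ ⋃ i, H i) :
    size (fun i => H i \ L) + L.ncard = size H := by
  have hfin := hE.subset (iUnion_subset fun i => (hH.1 i).1)
  rw [size, ← iUnion_sdiff, size, ncard_sdiff_add_ncard_of_subset hL hfin]

theorem size_le_OPT (hE : G.edgeSet.Finite) (hH : IsFeasible G k H) : size H ≤ OPT G k :=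
  (isGreatest_OPT G hE k).2 ⟨H, hH, rfl⟩

/-- Every feasible solution extends to an optimal one. -/
theorem IsFeasible.exists_optimal (hE : G.edgeSet.Finite) (hH : IsFeasible G k H) :
    ∃ J : Fin k → Set β, IsFeasible G k J ∧ ⋃ i, H i ⊆ ⋃ i, J i ∧ size J = OPT G k := by
  obtain ⟨J, hJ, hHJ, hmax⟩ :=
    ((isFeasible_iff (hE := hE)).1 hH).exists_isUnionMaximal hE
  have hJf := (isFeasible_iff (hE := hE)).2 hJ
  refine ⟨J, hJf, hHJ, (size_le_OPT hE hJf).antisymm ?_⟩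
  obtain ⟨K, hK, hKO⟩ := (isGreatest_OPT G hE k).1
  rw [← hKO]
  exact hmax.ncard_le hE hJ ((isFeasible_iff (hE := hE)).1 hK)

theorem IsContraction.isFeasible_union (hE : G.edgeSet.Finite) (h : IsContraction G L G')
    (hH : IsFeasible G k H) (hL : IsClump G k (⋃ i, H i) L) {T : Fin k → Set β}
    (hT : IsFeasible G' k T) : IsFeasible G k (fun i => T i ∪ H i ∩ L) := by
  have hLE := hL.1.trans ((isFeasible_iff (hE := hE)).1 hH).iUnion_subset
  refine ⟨fun i => (h.isForest_iff (hT.1 i).1 (isBasis_inter (hE := hE) hH hL i)).1 (hT.1 i),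
    fun i j hij => ?_⟩
  have hd : ∀ i, Disjoint (T i) L := fun i => disjoint_left.2 fun e he heL =>
    ((h.mem_edgeSet_iff (hE := hE) hLE).1 ((hT.1 i).1 he)).2
      ((cycleMatroid G hE).mem_closure_of_mem heL hLE)
  rw [disjoint_union_left, disjoint_union_right, disjoint_union_right]
  exact ⟨⟨hT.2 i j hij, (hd i).mono_right inter_subset_right⟩,
    ((hd j).mono_right inter_subset_right).symm,
    (hH.2 i j hij).mono inter_subset_left inter_subset_left⟩

/-- For ≤, the forests `H i ∩ L` are added to an optimum of `G'`. For ≥, an optimum containing the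
edges of `H` still has L as a clump, so removing L leaves a solution of `G'`. -/
theorem IsContraction.OPT_add_ncard (hE : G.edgeSet.Finite) (h : IsContraction G L G')
    (hH : IsFeasible G k H) (hL : IsClump G k (⋃ i, H i) L) :
    OPT G' k + L.ncard = OPT G k := by
  have hE' := hE.subset h.edgeSet_subset
  apply le_antisymm
  · obtain ⟨T, hT, hTO⟩ := (isGreatest_OPT G' hE' k).1
    have hf := h.isFeasible_union hE hH hL hT
    have hLE := hL.1.trans ((isFeasible_iff (hE := hE)).1 hH).iUnion_subset
    refine le_trans (le_of_eq ?_) (size_le_OPT hE hf)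
    have hTE : ⋃ i, T i ⊆ G'.edgeSet := iUnion_subset fun i => (hT.1 i).1
    have hd : Disjoint (⋃ i, T i) L := disjoint_left.2 fun e he heL =>
      ((h.mem_edgeSet_iff (hE := hE) hLE).1 (hTE he)).2
        ((cycleMatroid G hE).mem_closure_of_mem heL hLE)
    rw [size, iUnion_union_distrib, ← iUnion_inter, inter_eq_self_of_subset_right hL.1,
      ncard_union_eq hd (hE'.subset hTE) (hE.subset hLE), ← hTO, size]
  · obtain ⟨J, hJ, hHJ, hJO⟩ := hH.exists_optimal hE
    have hLJ : IsClump G k (⋃ i, J i) L := ⟨hL.1.trans hHJ, hL.2⟩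
    rw [← hJO, ← size_sdiff hE hJ hLJ.1]
    exact Nat.add_le_add_right (size_le_OPT hE' (h.isFeasible_sdiff hE hJ hLJ)) _

/-- After contracting a top clump, the remaining solution has no nonempty clump. -/
theorem IsContraction.eq_empty_of_isClump (hE : G.edgeSet.Finite) (h : IsContraction G L G')
    (hH : IsFeasible G k H) (hL : IsTopClump G k (⋃ i, H i) L) {D : Set β}
    (hD : IsClump G' k (⋃ i, H i \ L) D) : D = ∅ := by
  have hE' := hE.subset h.edgeSet_subset
  have hLE := hL.prop.1.trans ((isFeasible_iff (hE := hE)).1 hH).iUnion_subset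
  have hHf := hE.subset ((isFeasible_iff (hE := hE)).1 hH).iUnion_subset
  have hD1 : D ⊆ (⋃ i, H i) \ L := by rw [iUnion_sdiff]; exact hD.1
  have hDE : D ⊆ G'.edgeSet := hD.1.trans
    ((isFeasible_iff (hE := hE')).1 (h.isFeasible_sdiff hE hH hL.prop)).iUnion_subset
  have hdj : Disjoint L D := disjoint_right.2 fun e he => (hD1 he).2
  -- By maximality of L, a clump L ∪ D forces D ⊆ L, while D avoids L. It is a clump because the
  -- ranks of L and D add up.
  suffices IsClump G k (⋃ i, H i) (L ∪ D) by
    refine eq_empty_of_forall_notMem fun e he => (hD1 he).2 ?_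
    exact hL.le_of_ge this subset_union_left (.inr he)
  refine ⟨union_subset hL.prop.1 (hD1.trans sdiff_subset), ⟨H, hH.1,
    union_subset hL.prop.1 (hD1.trans sdiff_subset)⟩, ?_⟩
  obtain ⟨B, hB⟩ := (cycleMatroid G hE).exists_isBasis L hLE
  obtain ⟨C, hC⟩ := (cycleMatroid G' hE').exists_isBasis D hDE
  have hCB : IsForest G (C ∪ B) :=
    (h.isForest_iff (hC.subset.trans hDE) hB).1 (cycleMatroid_indep.1 hC.indep)
  have hbasis : (cycleMatroid G hE).IsBasis (C ∪ B) (L ∪ D) := by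
    refine (cycleMatroid_indep.2 hCB).isBasis_of_forall_insert
      (union_comm L D ▸ union_subset_union hC.subset hB.subset) ?_
    rintro e ⟨heL | heD, heCB⟩
    · have hecl : e ∈ (cycleMatroid G hE).closure B := hB.subset_closure heL
      exact (cycleMatroid_indep.2 hCB).insert_dep_iff.2
        ⟨(cycleMatroid G hE).closure_subset_closure subset_union_right hecl, heCB⟩
    · have heE : e ∈ (cycleMatroid G hE).E := h.edgeSet_subset (hDE heD)
      refine (Matroid.not_indep_iff
        (insert_subset heE (cycleMatroid_indep.2 hCB).subset_ground)).1 fun hi => heCB (.inl ?_)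
      rw [cycleMatroid_indep, ← insert_union, ← h.isForest_iff
        (insert_subset (hDE heD) (hC.subset.trans hDE)) hB] at hi
      exact hC.mem_of_insert_indep heD (cycleMatroid_indep.2 hi)
  rw [rk_eq_ncard hbasis, ncard_union_eq hdj (hE.subset hLE) (hE'.subset hDE),
    ncard_union_eq (hdj.symm.mono hC.subset hB.subset) (hE'.subset (hC.subset.trans hDE))
    (hE.subset hB.indep.subset_ground), hL.prop.2.2, hD.2.2, rk_eq_ncard hB, rk_eq_ncard hC]
  ring

end

/-! ### Rank, degree and component counting -/

section

variable {α β : Type*} {G : Graph α β} {k : ℕ}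

theorem finrank_supported {C : Set α} (hC : C.Finite) :
    Module.finrank (ZMod 2) (Finsupp.supported (ZMod 2) (ZMod 2) C) = C.ncard := by
  have := hC.fintype
  rw [(Finsupp.supportedEquivFinsupp C).finrank_eq, Module.finrank_finsupp_self,
    ncard_eq_toFinset_card', toFinset_card]

theorem finiteDimensional_supported {C : Set α} (hC : C.Finite) :
    FiniteDimensional (ZMod 2) (Finsupp.supported (ZMod 2) (ZMod 2) C) := by
  have := hC.to_subtype
  exact Module.Finite.equiv (Finsupp.supportedEquivFinsupp C).symm

theorem span_incidenceVec_le_supported {A : Set β} {C : Set α}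
    (h : ∀ e ∈ A, ∀ x, G.Inc e x → x ∈ C) :
    Submodule.span (ZMod 2) (incidenceVec G '' A) ≤ Finsupp.supported (ZMod 2) (ZMod 2) C := by
  rw [Submodule.span_le]
  rintro _ ⟨e, he, rfl⟩
  by_cases heE : e ∈ G.edgeSet
  · obtain ⟨x, y, hxy⟩ := Graph.exists_isLink_of_mem_edgeSet heE
    rw [incidenceVec_eq hxy]
    exact add_mem (Finsupp.single_mem_supported _ _ (h e he x hxy.inc_left))
      (Finsupp.single_mem_supported _ _ (h e he y hxy.inc_right))
  · rw [incidenceVec_of_notMem heE]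
    exact zero_mem _

/-- A connected edge set that reaches the vertices in `C` has rank at least `|C| - 1`. -/
theorem ncard_le_rk_add_one (hE : G.edgeSet.Finite) {A : Set β} (hA : A ⊆ G.edgeSet) {C : Set α}
    (hC : C.Finite) {c : α} (hc : ∀ z ∈ C, ConnectedBy G A c z) : C.ncard ≤ rk G A + 1 := by
  have := finiteDimensional_span_incidenceVec (G := G) (hE.subset hA)
  -- The vector of c together with the sums c + z, which A spans, generates all coordinate vectors
  -- of C.
  have hle : Finsupp.supported (ZMod 2) (ZMod 2) C ≤
      Submodule.span (ZMod 2) (incidenceVec G '' A) ⊔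
        Submodule.span (ZMod 2) {Finsupp.single c 1} := by
    rw [Finsupp.supported_eq_span_single, Submodule.span_le]
    rintro _ ⟨z, hz, rfl⟩
    have h1 := (hc z hz).add_mem_span
    have h2 : (Finsupp.single z 1 : α →₀ ZMod 2) =
        (Finsupp.single c 1 + Finsupp.single z 1) + Finsupp.single c 1 := by
      rw [add_comm (Finsupp.single c 1), add_assoc, zmod_two_add_self, add_zero]
    simp only [SetLike.mem_coe]
    rw [h2]
    exact add_mem (Submodule.mem_sup_left h1)
      (Submodule.mem_sup_right (Submodule.mem_span_singleton_self _))
  have h1 := Submodule.finrank_mono hle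
  rw [finrank_supported hC] at h1
  have h2 := Submodule.finrank_add_le_finrank_add_finrank
    (Submodule.span (ZMod 2) (incidenceVec G '' A))
    (Submodule.span (ZMod 2) {(Finsupp.single c 1 : α →₀ ZMod 2)})
  have h3 : Module.finrank (ZMod 2)
      (Submodule.span (ZMod 2) {(Finsupp.single c 1 : α →₀ ZMod 2)}) = 1 :=
    finrank_span_singleton (by simp)
  rw [rk_eq_finrank hE hA]
  omega

/-- The rank is additive over edge sets without common vertices. -/
theorem rk_add_rk_le (hE : G.edgeSet.Finite) {A₁ A₂ : Set β} (hA₁ : A₁ ⊆ G.edgeSet)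
    (hA₂ : A₂ ⊆ G.edgeSet) {C : Set α} (h₁ : ∀ e ∈ A₁, ∀ x, G.Inc e x → x ∈ C)
    (h₂ : ∀ e ∈ A₂, ∀ x, G.Inc e x → x ∈ Cᶜ) : rk G A₁ + rk G A₂ ≤ rk G (A₁ ∪ A₂) := by
  have := finiteDimensional_span_incidenceVec (G := G) (hE.subset hA₁)
  have := finiteDimensional_span_incidenceVec (G := G) (hE.subset hA₂)
  have hd : Disjoint (Submodule.span (ZMod 2) (incidenceVec G '' A₁))
      (Submodule.span (ZMod 2) (incidenceVec G '' A₂)) :=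
    (Finsupp.disjoint_supported_supported (disjoint_compl_right (a := C))).mono
      (span_incidenceVec_le_supported h₁) (span_incidenceVec_le_supported h₂)
  have h := Submodule.finrank_sup_add_finrank_inf_eq
    (Submodule.span (ZMod 2) (incidenceVec G '' A₁))
    (Submodule.span (ZMod 2) (incidenceVec G '' A₂))
  rw [hd.eq_bot, finrank_bot, add_zero, ← Submodule.span_union, ← image_union] at h
  rw [rk_eq_finrank hE hA₁, rk_eq_finrank hE hA₂, rk_eq_finrank hE (union_subset hA₁ hA₂), h]

theorem ncard_le_mul_ncard_of_indeg_le {A P : Set β} (hP : P.Finite) (hAP : A ⊆ P)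
    {head : β → α} {C : Set α} (hC : C.Finite) (hA : ∀ e ∈ A, head e ∈ C)
    (hdeg : ∀ v ∈ C, indeg P head v ≤ k) : A.ncard ≤ k * C.ncard := by
  classical
  have hAf := hP.subset hAP
  rw [ncard_eq_toFinset_card A hAf, ncard_eq_toFinset_card C hC]
  refine Finset.card_le_mul_card_image_of_maps_to (f := head) (by simpa using hA) k fun v hv => ?_
  refine le_trans ?_ (hdeg v (by simpa using hv))
  rw [indeg, ← ncard_coe_finset]
  refine ncard_le_ncard ?_ (hP.subset fun e he => he.1)
  intro e he
  simp only [Finset.coe_filter, Finite.mem_toFinset, mem_ofPred_eq] at he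
  exact ⟨hAP he.1, he.2⟩

theorem rk_mono (hE : G.edgeSet.Finite) {A B : Set β} (hAB : A ⊆ B) (hB : B ⊆ G.edgeSet) :
    rk G A ≤ rk G B := by
  have := finiteDimensional_span_incidenceVec (G := G) (hE.subset hB)
  rw [rk_eq_finrank hE (hAB.trans hB), rk_eq_finrank hE hB]
  exact Submodule.finrank_mono (Submodule.span_mono (image_mono hAB))

theorem ncard_inter_le_mul_rk (hE : G.edgeSet.Finite) {F : Fin k → Set β} (hF : IsFeasible G k F)
    {A : Set β} (hA : A ⊆ G.edgeSet) : ((⋃ i, F i) ∩ A).ncard ≤ k * rk G A := by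
  obtain ⟨B, hB⟩ := (cycleMatroid G hE).exists_isBasis A hA
  rw [rk_eq_ncard hB]
  exact ncard_iUnion_inter_le ((isFeasible_iff (hE := hE)).1 hF) hE hB

/-- A set of positive rank is not filled up by a feasible solution without nonempty clumps. -/
theorem ncard_inter_lt_mul_rk (hk : 0 < k) (hE : G.edgeSet.Finite) {F : Fin k → Set β}
    (hF : IsFeasible G k F) (hclump : ∀ D, IsClump G k (⋃ i, F i) D → D = ∅) {A : Set β}
    (hA : A ⊆ G.edgeSet) (hpos : 0 < rk G A) : ((⋃ i, F i) ∩ A).ncard < k * rk G A := by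
  refine (ncard_inter_le_mul_rk hE hF hA).lt_of_ne fun heq => ?_
  have hsub : (⋃ i, F i) ∩ A ⊆ G.edgeSet := inter_subset_right.trans hA
  have h1 := ncard_inter_le_mul_rk hE hF hsub
  rw [← inter_assoc, inter_self] at h1
  have h2 := Nat.mul_le_mul_left k
    (rk_mono hE (inter_subset_right : (⋃ i, F i) ∩ A ⊆ A) hA)
  -- With equality, F ∩ A would be a clump with k·rk(A) > 0 edges.
  have h3 := hclump ((⋃ i, F i) ∩ A)
    ⟨inter_subset_left, ⟨F, hF.1, inter_subset_left⟩, by omega⟩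
  rw [h3, ncard_empty] at heq
  have := Nat.mul_pos hk hpos
  omega

/-- The bound holds on each connected component of A, and all terms are additive over components.
The induction splits off one component at a time. -/
theorem ncard_sdiff_add_le (hk : 0 < k) (hl : G.Loopless) (hV : G.vertexSet.Finite)
    (hE : G.edgeSet.Finite) {F : Fin k → Set β} (hF : IsFeasible G k F)
    (hclump : ∀ D, IsClump G k (⋃ i, F i) D → D = ∅) {P : Set β} {head : β → α}
    (hP : IsIndegBounded G k P head) {A : Set β} (hA : A ⊆ P) :
    (A \ ⋃ i, F i).ncard + (k + 1) * ((⋃ i, F i) ∩ A).ncard ≤ (k + 1) * (k * rk G A) := by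
  induction hn : A.ncard using Nat.strong_induction_on generalizing A with
  | _ n ih =>
  rcases A.eq_empty_or_nonempty with rfl | ⟨e₀, he₀⟩
  · simp
  have hAE := hA.trans hP.1
  have hAf := hE.subset hAE
  obtain ⟨c, d, hcd⟩ := Graph.exists_isLink_of_mem_edgeSet (hAE he₀)
  set C : Set α := {z | ConnectedBy G A c z} with hCdef
  have hCV : C ⊆ G.vertexSet := by
    intro z hz
    induction hz with
    | refl => exact hcd.left_mem
    | tail _ h _ => exact h.choose_spec.2.right_mem
  have hCf := hV.subset hCV
  set A₁ : Set β := {e | e ∈ A ∧ ∀ x, G.Inc e x → x ∈ C} with hA₁def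
  have hA₁A : A₁ ⊆ A := fun e he => he.1
  have hcC : c ∈ C := .refl
  have hdC : d ∈ C := .single ⟨e₀, he₀, hcd⟩
  have hlink : ∀ e ∈ A, ∀ x y, G.IsLink e x y → x ∈ C → e ∈ A₁ := by
    intro e he x y hxy hx
    refine ⟨he, fun z hz => ?_⟩
    obtain rfl | rfl := hz.eq_or_eq_of_isLink hxy
    · exact hx
    · exact .tail hx ⟨e, he, hxy⟩
  have hout : ∀ e ∈ A \ A₁, ∀ x, G.Inc e x → x ∈ Cᶜ := by
    rintro e ⟨he, he₁⟩ x ⟨y, hxy⟩ hx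
    exact he₁ (hlink e he x y hxy hx)
  have hconn : ∀ z ∈ C, ConnectedBy G A₁ c z := by
    intro z hz
    induction hz with
    | refl => exact .refl
    | @tail a b ha h ih =>
      obtain ⟨e, he, hab⟩ := h
      exact .tail ih ⟨e, hlink e he a b hab ha, hab⟩
  have hrk := ncard_le_rk_add_one hE (hA₁A.trans hAE) hCf hconn
  -- Looplessness gives the component two vertices, hence positive rank, as the strict clump bound
  -- requires.
  have htwo : 2 ≤ C.ncard := by
    rw [← ncard_pair (a := c) (b := d) fun h => hl.not_isLoopAt e₀ c (h ▸ hcd)]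
    exact ncard_le_ncard (insert_subset hcC (singleton_subset_iff.2 hdC)) hCf
  have hlt := ncard_inter_lt_mul_rk hk hE hF hclump (hA₁A.trans hAE) (by omega)
  have hdeg : A₁.ncard ≤ k * C.ncard :=
    ncard_le_mul_ncard_of_indeg_le (hE.subset hP.1) (hA₁A.trans hA) hCf
      (fun e he => he.2 _ (hP.2.1 e (hA he.1))) fun v hv => hP.2.2 v (hCV hv)
  have hdeg' : A₁.ncard ≤ k * rk G A₁ + k :=
    hdeg.trans ((Nat.mul_le_mul_left k hrk).trans (by rw [mul_add, mul_one]))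
  have hsplit := ncard_inter_add_ncard_sdiff_eq_ncard A₁ (⋃ i, F i) (hAf.subset hA₁A)
  rw [inter_comm] at hsplit
  have hcard : (A \ A₁).ncard < n := by
    rw [← hn]
    exact ncard_lt_ncard ⟨sdiff_subset, fun h =>
      (h he₀).2 (hlink e₀ he₀ c d hcd hcC)⟩ hAf
  have ih' := ih _ hcard (sdiff_subset.trans hA) rfl
  have hadd := rk_add_rk_le hE (hA₁A.trans hAE) (sdiff_subset.trans hAE)
    (fun e he => he.2) hout
  rw [union_sdiff_cancel hA₁A] at hadd
  have e1 : (A \ ⋃ i, F i).ncard = (A₁ \ ⋃ i, F i).ncard + ((A \ A₁) \ ⋃ i, F i).ncard := by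
    rw [← ncard_union_eq (disjoint_sdiff_right.mono sdiff_subset sdiff_subset)
      (hAf.subset hA₁A).sdiff hAf.sdiff.sdiff, ← union_sdiff_distrib, union_sdiff_cancel hA₁A]
  have e2 : ((⋃ i, F i) ∩ A).ncard =
      ((⋃ i, F i) ∩ A₁).ncard + ((⋃ i, F i) ∩ (A \ A₁)).ncard := by
    rw [← ncard_union_eq (disjoint_sdiff_right.mono inter_subset_right inter_subset_right)
      ((hAf.subset hA₁A).inter_of_right _) (hAf.sdiff.inter_of_right _),
      ← inter_union_distrib_left, union_sdiff_cancel hA₁A]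
  rw [e1, e2]
  have hadd' := Nat.mul_le_mul_left (k + 1) (Nat.mul_le_mul_left k hadd)
  have key : (A₁ \ ⋃ i, F i).ncard + (k + 1) * ((⋃ i, F i) ∩ A₁).ncard ≤
      (k + 1) * (k * rk G A₁) := by
    set p := k * rk G A₁
    set q := ((⋃ i, F i) ∩ A₁).ncard
    set r := (A₁ \ ⋃ i, F i).ncard
    -- The deficit p - q is 1 + m, and 1 + m + k ≤ (k + 1)(1 + m).
    obtain ⟨m, hm⟩ : ∃ m, p = q + 1 + m := ⟨p - (q + 1), by omega⟩
    have h1 : r ≤ 1 + m + k := by omega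
    rw [hm]
    nlinarith [Nat.zero_le (k * m)]
  calc _ = ((A₁ \ ⋃ i, F i).ncard + (k + 1) * ((⋃ i, F i) ∩ A₁).ncard) +
      (((A \ A₁) \ ⋃ i, F i).ncard + (k + 1) * ((⋃ i, F i) ∩ (A \ A₁)).ncard) := by ring
    _ ≤ _ := add_le_add key ih'
    _ = (k + 1) * (k * (rk G A₁ + rk G (A \ A₁))) := by ring
    _ ≤ _ := hadd'

/-! ### Orienting forests -/

/-- A forest has an orientation with all indegrees at most one. -/
theorem IsForest.exists_injOn_inc {T : Set β} (hT : IsForest G T)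
    (head₀ : β → α) : ∃ head : β → α, InjOn head T ∧ ∀ e ∈ T, G.Inc e (head e) := by
  classical
  have hli := (isForest_iff.1 hT).2
  -- Hall's condition for assigning distinct ends to edges: independent vectors supported on C
  -- number at most |C|.
  have hall : ∀ s : Finset T,
      s.card ≤ (s.biUnion fun e => (incidenceVec G (e : β)).support).card := by
    intro s
    set C := s.biUnion fun e => (incidenceVec G (e : β)).support
    have hs : LinearIndependent (ZMod 2) fun e : s => incidenceVec G ((e : T) : β) :=
      hli.comp (fun e : s => (e : T)) Subtype.val_injective
    have hle : Submodule.span (ZMod 2) (range fun e : s => incidenceVec G ((e : T) : β)) ≤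
        Finsupp.supported (ZMod 2) (ZMod 2) (C : Set α) := by
      rw [Submodule.span_le]
      rintro _ ⟨e, rfl⟩
      rw [SetLike.mem_coe, Finsupp.mem_supported]
      exact_mod_cast Finset.subset_biUnion_of_mem
        (fun e : T => (incidenceVec G (e : β)).support) e.2
    have := finiteDimensional_supported C.finite_toSet
    have h := Submodule.finrank_mono hle
    rwa [finrank_span_eq_card hs, finrank_supported C.finite_toSet, Fintype.card_coe,
      ncard_coe_finset] at h
  obtain ⟨f, hf, hfs⟩ := (Finset.all_card_le_biUnion_card_iff_exists_injective _).1 hall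
  -- `head₀` only supplies values off T.
  refine ⟨fun e => if h : e ∈ T then f ⟨e, h⟩ else head₀ e, fun a ha b hb hab => ?_,
    fun e he => ?_⟩
  · simp only [ha, hb, dif_pos] at hab
    simpa using hf hab
  · simp only [he, dif_pos]
    have h := hfs ⟨e, he⟩
    obtain ⟨x, y, hxy⟩ := Graph.exists_isLink_of_mem_edgeSet (hT.1 he)
    rw [Finsupp.mem_support_iff, incidenceVec_eq hxy] at h
    by_cases hx : x = f ⟨e, he⟩
    · exact hx ▸ hxy.inc_left
    by_cases hy : y = f ⟨e, he⟩
    · exact hy ▸ hxy.inc_right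
    simp [hx, hy] at h

/-- The union of `k` disjoint forests has an orientation with all indegrees at most `k`. -/
theorem IsFeasible.exists_isIndegBounded (hE : G.edgeSet.Finite) {J : Fin k → Set β}
    (hJ : IsFeasible G k J) (head₀ : β → α) :
    ∃ head : β → α, IsIndegBounded G k (⋃ i, J i) head := by
  classical
  choose f hf hinc using fun i => (hJ.1 i).exists_injOn_inc head₀
  have huniq : ∀ e i j, e ∈ J i → e ∈ J j → i = j := fun e i j hi hj => by
    by_contra hij
    exact (hJ.2 i j hij).le_bot ⟨hi, hj⟩
  have hJE : ⋃ i, J i ⊆ G.edgeSet := iUnion_subset fun i => (hJ.1 i).1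
  set g : β → α := fun e => if h : ∃ i, e ∈ J i then f h.choose e else head₀ e
  have hg : ∀ i, ∀ e ∈ J i, g e = f i e := by
    intro i e he
    have h : ∃ i, e ∈ J i := ⟨i, he⟩
    simp only [g, dif_pos h, huniq e _ _ h.choose_spec he]
  refine ⟨g, hJE, fun e he => ?_, fun v _ => ?_⟩
  · obtain ⟨i, hi⟩ := mem_iUnion.1 he
    rw [hg i e hi]
    exact hinc i e hi
  · have hset : {e | e ∈ ⋃ i, J i ∧ g e = v} ⊆
        ⋃ i ∈ (Finset.univ : Finset (Fin k)), {e | e ∈ J i ∧ g e = v} := by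
      rintro e ⟨he, hev⟩
      obtain ⟨i, hi⟩ := mem_iUnion.1 he
      simp only [mem_iUnion]
      exact ⟨i, Finset.mem_univ i, hi, hev⟩
    have hfin : (⋃ i ∈ (Finset.univ : Finset (Fin k)), {e | e ∈ J i ∧ g e = v}).Finite := by
      refine hE.subset (iUnion₂_subset fun i _ e he => (hJ.1 i).1 he.1)
    refine (ncard_le_ncard hset hfin).trans ((Finset.set_ncard_biUnion_le _ _).trans ?_)
    refine (Finset.sum_le_card_nsmul _ _ 1 fun i _ => ?_).trans (by simp)
    have := (hE.subset (hJ.1 i).1).subset (sep_subset (J i) fun e => g e = v) |>.to_subtype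
    refine ncard_le_one_iff_subsingleton.2 ?_
    rintro a ⟨ha, hav⟩ b ⟨hb, hbv⟩
    rw [hg i a ha] at hav
    rw [hg i b hb] at hbv
    exact hf i ha hb (hav.trans hbv.symm)

/-! ### The bounded indegree problem inside P -/

theorem isForest_restrict_iff {P T : Set β} :
    IsForest (G.restrict P) T ↔ IsForest G T ∧ T ⊆ P := by
  simp only [IsForest, Graph.edgeSet_restrict, Graph.restrict_isLink, subset_inter_iff]
  constructor
  · rintro ⟨⟨h1, h2⟩, h3⟩
    refine ⟨⟨h1, ?_⟩, h2⟩
    rintro ⟨n, v, e, hv, he, h⟩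
    exact h3 ⟨n, v, e, hv, he, fun i => ⟨(h i).1, h2 (h i).1, (h i).2⟩⟩
  · rintro ⟨⟨h1, h3⟩, h2⟩
    refine ⟨⟨h1, h2⟩, ?_⟩
    rintro ⟨n, v, e, hv, he, h⟩
    exact h3 ⟨n, v, e, hv, he, fun i => ⟨(h i).1, (h i).2.2⟩⟩

theorem isFeasible_restrict_iff {P : Set β} {H : Fin k → Set β} :
    IsFeasible (G.restrict P) k H ↔ IsFeasible G k H ∧ ⋃ i, H i ⊆ P := by
  simp only [IsFeasible, isForest_restrict_iff, forall_and, iUnion_subset_iff]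
  tauto

theorem rk_restrict {P A : Set β} (hA : A ⊆ P) : rk (G.restrict P) A = rk G A := by
  unfold rk
  congr 1
  ext m
  refine exists_congr fun T => ⟨?_, ?_⟩
  · rintro ⟨h1, h2, h3⟩
    exact ⟨(isForest_restrict_iff.1 h1).1, h2, h3⟩
  · rintro ⟨h1, h2, h3⟩
    exact ⟨isForest_restrict_iff.2 ⟨h1, h2.trans hA⟩, h2, h3⟩

/-- A solution of the bounded indegree directed `k`-forest problem in a set `P` whose indegrees
are at most `k` is a maximum `k`-forest in `P`, hence determined by a tight set. -/
theorem IsBoundedIndegreeForestsOutput.exists_tight (hE : G.edgeSet.Finite) {P : Set β}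
    {head : β → α} (hP : IsIndegBounded G k P head) {H : Fin k → Set β}
    (hH : IsBoundedIndegreeForestsOutput (G.restrict P) head k H) :
    ∃ A ⊆ P, size H = (P \ A).ncard + k * rk G A := by
  have hPf := hE.subset hP.1
  have hgr : (G.restrict P).edgeSet = P := inter_eq_self_of_subset_right hP.1
  have hEP : (G.restrict P).edgeSet.Finite := by rwa [hgr]
  have hHi := (isFeasible_iff (hE := hEP)).1 hH.1.1
  -- Every k-forest in P inherits indegrees at most k from P, so the degree constraint costs
  -- nothing.
  have hmax : IsUnionMaximal (cycleMatroid (G.restrict P) hEP) H := by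
    intro x _ hxH J hJ hJH
    have hJf := (isFeasible_iff (hE := hEP)).2 hJ
    have hJP := (isFeasible_restrict_iff.1 hJf).2
    have hsub : ∀ v, {e | e ∈ ⋃ i, J i ∧ head e = v} ⊆ {e | e ∈ P ∧ head e = v} :=
      fun v e he => ⟨hJP he.1, he.2⟩
    have hle := hH.2 J ⟨hJf, fun v hv =>
      (ncard_le_ncard (hsub v) (hPf.subset fun e he => he.1)).trans (hP.2.2 v hv)⟩
    rw [size, size, hJH, ncard_insert_of_notMem hxH (hEP.subset hHi.iUnion_subset)] at hle
    omega
  obtain ⟨A, hAE, hA, hHA⟩ := KForest.exists_tight hHi hmax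
  rw [cycleMatroid_ground, hgr] at hAE hA
  have hHP := (isFeasible_restrict_iff.1 hH.1.1).2
  obtain ⟨B, hB⟩ := (cycleMatroid (G.restrict P) hEP).exists_isBasis A
    (by rwa [cycleMatroid_ground, hgr])
  refine ⟨A, hAE, ?_⟩
  have hdiff : (⋃ i, H i) \ A = P \ A := by
    refine Subset.antisymm (sdiff_subset_sdiff_left hHP) fun e he => ⟨?_, he.2⟩
    by_contra h
    have heA : e ∈ P \ ⋃ i, H i := ⟨he.1, h⟩
    exact he.2 (hA heA)
  rw [← rk_restrict hAE, rk_eq_ncard hB, ← ncard_iUnion_of_isBasis hHi hEP hB hHA, size,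
    ← ncard_inter_add_ncard_sdiff_eq_ncard (⋃ i, H i) A (hPf.subset hHP), add_comm, hdiff]

/-! ### The loop invariant and the two estimates -/

/-- The properties of the current graph and solution at the beginning of an iteration. -/
structure IsLoopInvariant (k : ℕ) (G : Graph α β) (F : Fin k → Set β) : Prop where
  loopless : G.Loopless
  finite_vertexSet : G.vertexSet.Finite
  finite_edgeSet : G.edgeSet.Finite
  isFeasible : IsFeasible G k F
  eq_empty_of_isClump : ∀ D, IsClump G k (⋃ i, F i) D → D = ∅

theorem IsIteration.isLoopInvariant {G' : Graph α β} {F F' H : Fin k → Set β}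
    (h : IsLoopInvariant k G F) (hiter : IsIteration k G F H G' F') :
    IsLoopInvariant k G' F' := by
  obtain ⟨-, P, head, L, -, -, hH, hL, hG', hF'⟩ := hiter
  have hE := h.finite_edgeSet
  have hHG := (isFeasible_restrict_iff.1 hH.1.1).1
  obtain rfl : F' = fun i => H i \ L :=
    funext fun i => (hF' i).trans (hG'.inter_edgeSet hE hHG hL.prop i)
  exact ⟨hG'.loopless, hG'.finite_vertexSet h.finite_vertexSet, hE.subset hG'.edgeSet_subset,
    hG'.isFeasible_sdiff hE hHG hL.prop, fun D hD => hG'.eq_empty_of_isClump hE hHG hL hD⟩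

theorem AtLoopStart.isLoopInvariant {G₀ : Graph α β} (hl : G₀.Loopless)
    (hV : G₀.vertexSet.Finite) (hE : G₀.edgeSet.Finite) {F : Fin k → Set β}
    (h : AtLoopStart k G₀ G F) : IsLoopInvariant k G F := by
  induction h with
  | start =>
    refine ⟨hl, hV, hE, ⟨fun i => isForest_iff.2
      ⟨empty_subset _, linearIndepOn_empty _ _⟩, fun i j _ => disjoint_bot_left⟩, fun D hD => ?_⟩
    simpa using hD.1
  | next _ hiter ih => exact hiter.isLoopInvariant ih

theorem IsIteration.OPT_sub_size_eq {G' : Graph α β} {F F' H : Fin k → Set β}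
    (hE : G.edgeSet.Finite) (hiter : IsIteration k G F H G' F') :
    OPT G' k + size H = OPT G k + size F' := by
  obtain ⟨-, P, head, L, -, -, hH, hL, hG', hF'⟩ := hiter
  have hHG := (isFeasible_restrict_iff.1 hH.1.1).1
  obtain rfl : F' = fun i => H i \ L :=
    funext fun i => (hF' i).trans (hG'.inter_edgeSet hE hHG hL.prop i)
  have h1 := size_sdiff hE hHG hL.prop.1
  have h2 := hG'.OPT_add_ncard hE hHG hL.prop
  omega

/-- This is OPT - |F| ≤ (k+1)(|H| - |F|) without subtraction. Inside the tight set A the component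
count applies; outside it `H` contains all of P. -/
theorem IsIteration.OPT_add_mul_size_le (hk : 0 < k) {G' : Graph α β} {F F' H : Fin k → Set β}
    (h : IsLoopInvariant k G F) (hiter : IsIteration k G F H G' F') :
    OPT G k + k * size F ≤ (k + 1) * size H := by
  obtain ⟨head₀, P, head, L, -, ⟨hFP, hP, hPmax⟩, hH, -⟩ := hiter
  have hE := h.finite_edgeSet
  have hPf := hE.subset hP.1
  obtain ⟨J, hJ, hFJ, hJO⟩ := h.isFeasible.exists_optimal hE
  obtain ⟨head', hJb⟩ := hJ.exists_isIndegBounded hE head₀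
  -- An optimum containing F competes in the maximization that defines P.
  have hOP : OPT G k ≤ P.ncard := hJO ▸ hPmax _ head' hFJ hJb
  obtain ⟨A, hAP, hA⟩ := hH.exists_tight hE hP
  have hcount := ncard_sdiff_add_le hk h.loopless h.finite_vertexSet hE h.isFeasible
    h.eq_empty_of_isClump hP hAP
  set U := ⋃ i, F i with hU
  have hUf := hPf.subset hFP
  have s1 := ncard_inter_add_ncard_sdiff_eq_ncard U A hUf
  have s2 := ncard_sdiff_add_ncard_of_subset hAP hPf
  have s3 := ncard_inter_add_ncard_sdiff_eq_ncard A U (hPf.subset hAP)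
  rw [inter_comm] at s3
  have s4 : (U \ A).ncard ≤ (P \ A).ncard := ncard_le_ncard (sdiff_subset_sdiff_left hFP) hPf.sdiff
  have s5 := Nat.mul_le_mul_left k s4
  have hs : size F = U.ncard := rfl
  rw [hA, hs, ← s1]
  nlinarith

end

end KForest

theorem mainTheorem3 {α β : Type*} (k : ℕ) (hk : 0 < k)
    (G₀ : Graph α β) (hloopless : G₀.Loopless)
    (hV : G₀.vertexSet.Finite) (hE : G₀.edgeSet.Finite)
    (G : Graph α β) (F : Fin k → Set β) (hstart : KForest.AtLoopStart k G₀ G F)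
    (H : Fin k → Set β) (G' : Graph α β) (F' : Fin k → Set β)
    (hiter : KForest.IsIteration k G F H G' F') :
    (KForest.OPT G' k : ℝ) - (KForest.size F' : ℝ) =
        (KForest.OPT G k : ℝ) - (KForest.size H : ℝ) ∧
      (KForest.OPT G k : ℝ) - (KForest.size H : ℝ) ≤
        ((k : ℝ) / ((k : ℝ) + 1)) * ((KForest.OPT G k : ℝ) - (KForest.size F : ℝ)) := by
  have hinv := hstart.isLoopInvariant hloopless hV hE
  have h1 := hiter.OPT_sub_size_eq hinv.finite_edgeSet
  have h2 := hiter.OPT_add_mul_size_le hk hinv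
  rify at h1 h2
  refine ⟨by linarith, ?_⟩
  rw [div_mul_eq_mul_div, le_div_iff₀ (by positivity)]
  nlinarith
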